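/- Let $k$ be a field, $n\ge 1$, and let $\Delta_n$ be the quiver with vertices $1,\dots,n$ (read modulo $n$) and one arrow $x_a\colon a\to\tau(a)=a+1$ for each vertex $a$. Let $A$ be a finite-dimensional Nakayama algebra of order $n$ over $k$, i.e. $A\cong k\Delta_n/(\mathcal R)$ for a finite set $\mathcal R$ of nontrivial paths, where $(\mathcal R)$ is the two-sided ideal generated by $\mathcal R$ and paths are multiplied from left to right. Let $A=\bigoplus_{\ell\ge 0}A_\ell$ be the length grading ($\deg x_a=1$ for all $a$). For a vertex $a$ let $e_a$ be its idempotent, $P_a=e_aA$ the projective right module, $S_a$ its simple top, and $p_a=\dim_k P_a$. The graded Cartan matrix is $C_A(t)=(c_{ab}(t))_{a,b}$ with $c_{ab}(t)=\sum_\ell \dim_k(e_bA_\ell e_a)\,t^\ell$. Let $\gamma(a)=\tau^{p_a}(a)$. The resolution quiver $R_A$ has vertices $1,\dots,n$ and exactly one arrow $a\to\gamma(a)$ for each $a$. A vertex is cyclic if it lies on a cycle of $R_A$; the weight of a cycle $I$ is $\frac1n\sum_{b\in I}p_b$; and $n_a$ is the number of vertices of the connected component of $R_A$ containing $a$. Then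 there is a unique vector $\alpha(t)=(\alpha_a(t))_a$ over $\mathbb Q(t)$ with $C_A(t)\,\alpha(t)=(1,\dots,1)^{T}$. No $\alpha_a(t)$ has a pole at $t=1$, and: 1. if $a$ is not cyclic in $R_A$, then $\alpha_a(1)=0$; 2. if $a$ is cyclic in $R_A$, then $\alpha_a(1)=\dfrac{n_a}{n\,w}$, where $w$ is the weight of any cycle of $R_A$ (in particular, all cycles have the same weight). Moreover, the following two conditions on $A$ (Madsen's and Shen's criteria for finite global dimension) are equivalent: (a) there is a cyclic vertex $a$ of $R_A$ such that the right module $S_a$ has finite even injective dimension; (b) $R_A$ is connected and its weight $w$ is $1$. -/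

import Mathlib

universe u v

/-! ### The path algebra of the cyclic quiver `Δ_n`

The vertices `1, …, n` of `Δ_n` are the elements of `ZMod n` (the vertex `n` is the class of `0`),
and there is exactly one arrow `x_a : a → a + 1` for every vertex `a`. -/

/-- A path of `Δ_n`. There is exactly one path of each length starting at each vertex, so a path
is recorded by its source and its length: the path `(a, ℓ)` is `x_a x_{a+1} ⋯ x_{a+ℓ-1}`. -/
@[ext]
structure CyclicPath (n : ℕ) where
  source : ZMod n
  length : ℕ

namespace CyclicPath

variable {n : ℕ}

/-- The end point of a path. -/
def target (p : CyclicPath n) : ZMod n := p.source + (p.length : ZMod n)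

/-- The trivial path at a vertex. -/
def trivial (a : ZMod n) : CyclicPath n := ⟨a, 0⟩

/-- Concatenation "first `p`, then `q`"; it is used only if `p.target = q.source`. -/
def comp (p q : CyclicPath n) : CyclicPath n := ⟨p.source, p.length + q.length⟩

theorem target_comp (p q : CyclicPath n) (h : p.target = q.source) :
    (p.comp q).target = q.target := by
  simp only [target, comp] at *
  rw [← h]
  push_cast
  ring

end CyclicPath

/-- The path algebra `kΔ_n`: the vector space with basis the paths of `Δ_n`. Products of paths
are read from left to right. -/
def PathAlgebra (k : Type u) [Field k] (n : ℕ) : Type u := CyclicPath n →₀ k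

namespace PathAlgebra

variable (k : Type u) [Field k] (n : ℕ)

noncomputable instance : AddCommGroup (PathAlgebra k n) :=
  inferInstanceAs (AddCommGroup (CyclicPath n →₀ k))

noncomputable instance : Module k (PathAlgebra k n) :=
  inferInstanceAs (Module k (CyclicPath n →₀ k))

/-- A path, as an element of the path algebra. -/
noncomputable def ofPath {n : ℕ} (p : CyclicPath n) : PathAlgebra k n := Finsupp.single p (1 : k)

/-- The basis of `kΔ_n` given by the paths. -/
noncomputable def pathBasis : Module.Basis (CyclicPath n) k (PathAlgebra k n) :=
  Module.Basis.ofRepr (LinearEquiv.refl k (CyclicPath n →₀ k))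

theorem pathBasis_apply (p : CyclicPath n) : pathBasis k n p = ofPath k p := rfl

/-- The multiplication as a bilinear map: the product of the paths `p` and `q` is the
concatenation `pq` if `p` ends where `q` starts, and `0` otherwise. -/
noncomputable def mulBilin :
    PathAlgebra k n →ₗ[k] PathAlgebra k n →ₗ[k] PathAlgebra k n :=
  (pathBasis k n).constr k fun p => (pathBasis k n).constr k fun q =>
    if p.target = q.source then ofPath k (p.comp q) else 0

theorem mulBilin_ofPath (p q : CyclicPath n) :
    mulBilin k n (ofPath k p) (ofPath k q) =
      if p.target = q.source then ofPath k (p.comp q) else 0 := by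
  rw [← pathBasis_apply, ← pathBasis_apply, mulBilin, Module.Basis.constr_basis,
    Module.Basis.constr_basis]

theorem mulBilin_assoc (x y z : PathAlgebra k n) :
    mulBilin k n (mulBilin k n x y) z = mulBilin k n x (mulBilin k n y z) := by
  have key : (mulBilin k n).compr₂ (mulBilin k n) =
      (LinearMap.llcomp k (PathAlgebra k n) (PathAlgebra k n) (PathAlgebra k n)).compl₁₂
        (mulBilin k n) (mulBilin k n) := by
    refine (pathBasis k n).ext fun p => (pathBasis k n).ext fun q => (pathBasis k n).ext fun r => ?_
    simp only [LinearMap.compr₂_apply, LinearMap.compl₁₂_apply,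
      LinearMap.llcomp_apply, pathBasis_apply, mulBilin_ofPath]
    by_cases h₁ : p.target = q.source <;> by_cases h₂ : q.target = r.source
    · have h₃ : (p.comp q).target = r.source := by rw [CyclicPath.target_comp p q h₁, h₂]
      simp only [h₁, h₂, if_true, mulBilin_ofPath, h₃]
      simp [CyclicPath.comp, Nat.add_assoc]
    · have h₃ : ¬ (p.comp q).target = r.source := by rwa [CyclicPath.target_comp p q h₁]
      simp [h₁, h₂, mulBilin_ofPath, h₃]
    · have h₄ : ¬ p.target = (q.comp r).source := h₁
      simp [h₁, h₂, mulBilin_ofPath, h₄]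
    · simp [h₁, h₂]
  exact LinearMap.congr_fun (LinearMap.congr_fun (LinearMap.congr_fun key x) y) z

noncomputable instance : Mul (PathAlgebra k n) := ⟨fun x y => mulBilin k n x y⟩

theorem mul_def (x y : PathAlgebra k n) : x * y = mulBilin k n x y := rfl

theorem ofPath_mul_ofPath (p q : CyclicPath n) :
    ofPath k p * ofPath k q = if p.target = q.source then ofPath k (p.comp q) else 0 :=
  mulBilin_ofPath k n p q

variable [NeZero n]

/-- The unit is the sum of the trivial paths. -/
noncomputable instance : One (PathAlgebra k n) :=
  ⟨∑ a : ZMod n, ofPath k (CyclicPath.trivial a)⟩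

theorem one_def : (1 : PathAlgebra k n) = ∑ a : ZMod n, ofPath k (CyclicPath.trivial a) := rfl

theorem mulBilin_one_left (x : PathAlgebra k n) : mulBilin k n 1 x = x := by
  have key : mulBilin k n 1 = LinearMap.id := by
    refine (pathBasis k n).ext fun p => ?_
    simp [one_def, pathBasis_apply, mulBilin_ofPath, CyclicPath.target, CyclicPath.trivial,
      CyclicPath.comp]
  rw [key, LinearMap.id_apply]

theorem mulBilin_one_right (x : PathAlgebra k n) : mulBilin k n x 1 = x := by
  have key : (mulBilin k n).flip 1 = LinearMap.id := by
    refine (pathBasis k n).ext fun p => ?_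
    simp [one_def, pathBasis_apply, mulBilin_ofPath, CyclicPath.trivial, CyclicPath.comp]
  exact LinearMap.congr_fun key x

noncomputable instance : Ring (PathAlgebra k n) :=
  { (inferInstance : AddCommGroup (PathAlgebra k n)),
    (inferInstance : Mul (PathAlgebra k n)),
    (inferInstance : One (PathAlgebra k n)) with
    left_distrib := fun x y z => map_add (mulBilin k n x) y z
    right_distrib := fun x y z => LinearMap.map_add₂ (mulBilin k n) x y z
    zero_mul := fun x => LinearMap.map_zero₂ (mulBilin k n) x
    mul_zero := fun x => map_zero (mulBilin k n x)
    mul_assoc := mulBilin_assoc k n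
    one_mul := mulBilin_one_left k n
    mul_one := mulBilin_one_right k n }

noncomputable instance : Algebra k (PathAlgebra k n) :=
  Algebra.ofModule (fun r x y => LinearMap.map_smul₂ (mulBilin k n) r x y)
    (fun r x y => map_smul (mulBilin k n x) r y)

end PathAlgebra

/-! ### Nakayama algebras -/

/-- The rational function `f` has no pole at `1` and its value there is `c`. -/
def RatFunc.HasValueAtOne (f : RatFunc ℚ) (c : ℚ) : Prop :=
  f.denom.eval 1 ≠ 0 ∧ f.eval (RingHom.id ℚ) 1 = c

/-- A presentation of the `k`-algebra `A` as a Nakayama algebra of order `n`: an isomorphism of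
`A` with the quotient of `kΔ_n` by the two-sided ideal generated by a finite set of nontrivial
paths, given as a surjection `kΔ_n → A` with that ideal as its kernel. -/
structure NakayamaPresentation (k : Type u) [Field k] (n : ℕ) [NeZero n]
    (A : Type v) [Ring A] [Algebra k A] where
  proj : PathAlgebra k n →ₐ[k] A
  proj_surjective : Function.Surjective proj
  relations : Finset (CyclicPath n)
  nontrivial_relations : ∀ p ∈ relations, 1 ≤ p.length
  ker_proj : TwoSidedIdeal.ker proj =
    TwoSidedIdeal.span {x | ∃ p ∈ relations, x = PathAlgebra.ofPath k p}

namespace NakayamaPresentation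

variable {k : Type u} [Field k] {n : ℕ} [NeZero n] {A : Type v} [Ring A] [Algebra k A]
  (N : NakayamaPresentation k n A)

/-- The idempotent `e_a` of `A`. -/
noncomputable def idem (a : ZMod n) : A := N.proj (PathAlgebra.ofPath k (CyclicPath.trivial a))

/-- The degree `ℓ` part `A_ℓ` of `A` for the length grading (every arrow has degree `1`): the span
of the classes of the paths of length `ℓ`. -/
noncomputable def gradedPart (l : ℕ) : Submodule k A :=
  Submodule.span k {x | ∃ p : CyclicPath n, p.length = l ∧ x = N.proj (PathAlgebra.ofPath k p)}

/-- The subspace `e_b A_ℓ e_a` of `A`. -/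
noncomputable def peirceGradedPart (b a : ZMod n) (l : ℕ) : Submodule k A :=
  (N.gradedPart l).map
    ((LinearMap.mulLeft k (N.idem b)).comp (LinearMap.mulRight k (N.idem a)))

/-- The graded Cartan matrix of `A` for the length grading, with entries
`c_{ab}(t) = ∑_ℓ dim_k (e_b A_ℓ e_a) t^ℓ`. The sum has only finitely many nonzero terms if `A`
is finite-dimensional. -/
noncomputable def gradedCartan : Matrix (ZMod n) (ZMod n) (Polynomial ℤ) :=
  Matrix.of fun a b =>
    ∑ᶠ l : ℕ, Polynomial.monomial l (Module.finrank k (N.peirceGradedPart b a l) : ℤ)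

/-- The graded Cartan matrix over the field `ℚ(t)`. -/
noncomputable def gradedCartanRat : Matrix (ZMod n) (ZMod n) (RatFunc ℚ) :=
  N.gradedCartan.map fun f =>
    algebraMap (Polynomial ℚ) (RatFunc ℚ) (f.map (Int.castRingHom ℚ))

/-- The indecomposable projective right module `P_a = e_a A`. -/
noncomputable def projModule (a : ZMod n) : Submodule Aᵐᵒᵖ A := Submodule.span Aᵐᵒᵖ {N.idem a}

/-- The dimension `p_a` of `P_a = e_a A` over `k`. -/
noncomputable def projDim (a : ZMod n) : ℕ :=
  Module.finrank k (LinearMap.range (LinearMap.mulLeft k (N.idem a)))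

/-- The simple right module `S_a`, the top of `P_a`. -/
noncomputable abbrev simpleModule (a : ZMod n) : Type v :=
  N.projModule a ⧸ Module.jacobson Aᵐᵒᵖ (N.projModule a)

/-- The injective dimension of `S_a` as a right `A`-module. -/
noncomputable def simpleInjDim (a : ZMod n) : WithBot ℕ∞ :=
  CategoryTheory.injectiveDimension (ModuleCat.of Aᵐᵒᵖ (N.simpleModule a))

/-- The map `τ(a) = a + 1` on vertices (so `τ(n) = 1`). -/
def tau (a : ZMod n) : ZMod n := a + 1

/-- The Gustafson function `γ(a) = τ^{p_a}(a)`. The resolution quiver `R_A` is its functional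
graph: the vertices are those of `Δ_n`, with exactly one arrow `a → γ(a)` for each vertex `a`. -/
noncomputable def gamma (a : ZMod n) : ZMod n := tau^[N.projDim a] a

/-- The vertex `a` lies on a cycle of the resolution quiver. -/
def IsCyclic (a : ZMod n) : Prop := a ∈ Function.periodicPts N.gamma

/-- The weight `∑_{b ∈ I} p_b / n` of the cycle `I = {a, γ(a), γ²(a), …}` through a cyclic
vertex `a`. -/
noncomputable def weight (a : ZMod n) : ℚ :=
  (∑ i ∈ Finset.range (Function.minimalPeriod N.gamma a), (N.projDim (N.gamma^[i] a) : ℚ)) / n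

/-- Two vertices lie in the same connected component of the resolution quiver. -/
def SameComponent (a b : ZMod n) : Prop := Relation.EqvGen (fun x y => N.gamma x = y) a b

/-- The number `n_a` of vertices of the component of the resolution quiver containing `a`. -/
noncomputable def componentCard (a : ZMod n) : ℕ := Nat.card {b : ZMod n // N.SameComponent a b}

/-- The resolution quiver is connected. -/
def IsConnected : Prop := ∀ a b : ZMod n, N.SameComponent a b

/-- `α` is a weighting on the graded Cartan matrix: `C(t) α = (1, …, 1)ᵀ`. -/
def IsWeighting (α : ZMod n → RatFunc ℚ) : Prop :=
  N.gradedCartanRat.mulVec α = fun _ => 1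

end NakayamaPresentation

/-! The algebra has a monomial basis, the paths containing no relation, so `e_b A` has basis the
paths from `b` of length less than `p_b`, and column `b` of the Cartan matrix lists `1, t, …, t^(p_b
- 1)` along consecutive vertices.

Weightings. Subtracting `t` times row `a - 1` from row `a` telescopes every column and leaves `α_a =
1 - t + ∑_{γ(b) = a} t^{p_b} α_b` (`IsWeighting.eq_add_sum`). Away from the cycles this recursion is
finite, so `α_a` is `1 - t` times a function regular at `1`. Along a cycle the side branches
contribute only multiples of `1 - t`. Hence `α` is regular there and takes one value `c` at `1` on
the whole cycle. Summing the recursion over a component and cancelling `1 - t` gives `∑ (1 + ⋯ +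
t^(p_b - 1)) α_b = n_a`; at `t = 1` this reads `n w c = n_a`.

Equal weights. The inequality `p_x ≤ p_{x+1} + 1` makes the lift `f(x) = x + p_x` of `γ` to the
integers monotone, and `f(x + n) = f(x) + n`. As for rotation numbers, all periodic points of such a
map share their period and displacement (`iterate_eq_of_degree_one`).

Criteria. A uniserial module is an integer interval `[x, y)` with `y ≤ f(x)`. If `g` is the lower
adjoint of `f`, its injective envelope is `[g(y), y)` and its cosyzygy `[g(y), x)`. Starting from
`[a, a + 1)`, the injective dimension of `S_a` is therefore read off from coincidences among the
`g^j(a)` and `g^j(a + 1)`. For cyclic `a`, by adjunction, it is finite and even exactly when no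
cyclic orbit of `f` jumps over `a`. This means that the cyclic integers form a single `f`-orbit: one
component, weight `1`. -/

namespace PathAlgebra

variable {k : Type u} [Field k] {n : ℕ}

@[elab_as_elim]
theorem induction_on {P : PathAlgebra k n → Prop} (x : PathAlgebra k n)
    (zero : P 0) (add : ∀ x y, P x → P y → P (x + y))
    (smul_ofPath : ∀ (c : k) (p : CyclicPath n), P (c • ofPath k p)) : P x := by
  have hx : x ∈ Submodule.span k (Set.range (pathBasis k n)) := by
    rw [Module.Basis.span_eq]; trivial
  obtain ⟨c, rfl⟩ := Finsupp.mem_span_range_iff_exists_finsupp.1 hx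
  exact Finset.sum_induction _ P add zero fun p _ => smul_ofPath _ p

end PathAlgebra

/-! ### The monomial basis and its coefficient functionals -/

namespace NakayamaPresentation

open PathAlgebra

section

variable {k : Type u} [Field k] {n : ℕ} [NeZero n] {A : Type v} [Ring A] [Algebra k A]
  (N : NakayamaPresentation k n A)

/-- The path `p` has one of the relations as a subpath. -/
def ContainsRelation (p : CyclicPath n) : Prop :=
  ∃ r ∈ N.relations, ∃ i : ℕ, r.source = p.source + i ∧ i + r.length ≤ p.length

variable {N} in
theorem ContainsRelation.comp_right {p : CyclicPath n} (hp : N.ContainsRelation p)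
    (q : CyclicPath n) : N.ContainsRelation (p.comp q) := by
  obtain ⟨r, hr, i, h1, h2⟩ := hp
  exact ⟨r, hr, i, h1, by simp only [CyclicPath.comp]; omega⟩

variable {N} in
theorem ContainsRelation.comp_left {p : CyclicPath n} (hp : N.ContainsRelation p)
    (q : CyclicPath n) (h : q.target = p.source) : N.ContainsRelation (q.comp p) := by
  obtain ⟨r, hr, i, h1, h2⟩ := hp
  refine ⟨r, hr, q.length + i, ?_, by simp only [CyclicPath.comp]; omega⟩
  rw [h1, ← h]
  simp [CyclicPath.comp, CyclicPath.target, add_assoc]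

/-- The subspace of the path algebra spanned by the paths containing a relation. -/
noncomputable def relationSpan : Submodule k (PathAlgebra k n) :=
  Submodule.span k {x | ∃ p, N.ContainsRelation p ∧ x = ofPath k p}

theorem mul_mem_relationSpan_right {x : PathAlgebra k n} (hx : x ∈ N.relationSpan)
    (y : PathAlgebra k n) : x * y ∈ N.relationSpan := by
  induction hx using Submodule.span_induction with
  | mem x hx =>
    obtain ⟨p, hp, rfl⟩ := hx
    induction y using PathAlgebra.induction_on with
    | zero => simp
    | add a b ha hb => rw [mul_add]; exact add_mem ha hb
    | smul_ofPath c q =>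
      rw [mul_smul_comm, ofPath_mul_ofPath]
      refine Submodule.smul_mem _ _ ?_
      split_ifs
      · exact Submodule.subset_span ⟨_, hp.comp_right q, rfl⟩
      · exact zero_mem _
  | zero => simp
  | add a b _ _ ha hb => rw [add_mul]; exact add_mem ha hb
  | smul c a _ ha => rw [smul_mul_assoc]; exact Submodule.smul_mem _ _ ha

theorem mul_mem_relationSpan_left (y : PathAlgebra k n) {x : PathAlgebra k n}
    (hx : x ∈ N.relationSpan) : y * x ∈ N.relationSpan := by
  induction hx using Submodule.span_induction with
  | mem x hx =>
    obtain ⟨p, hp, rfl⟩ := hx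
    induction y using PathAlgebra.induction_on with
    | zero => simp
    | add a b ha hb => rw [add_mul]; exact add_mem ha hb
    | smul_ofPath c q =>
      rw [smul_mul_assoc, ofPath_mul_ofPath]
      refine Submodule.smul_mem _ _ ?_
      split_ifs with h
      · exact Submodule.subset_span ⟨_, hp.comp_left q h, rfl⟩
      · exact zero_mem _
  | zero => simp
  | add a b _ _ ha hb => rw [mul_add]; exact add_mem ha hb
  | smul c a _ ha => rw [mul_smul_comm]; exact Submodule.smul_mem _ _ ha

/-- The span of the paths through a relation is itself a two-sided ideal containing the generators,
so it contains the kernel. -/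
theorem mem_relationSpan_of_proj_eq_zero {x : PathAlgebra k n} (hx : N.proj x = 0) :
    x ∈ N.relationSpan := by
  let J : TwoSidedIdeal (PathAlgebra k n) := TwoSidedIdeal.mk' (N.relationSpan : Set _)
    (zero_mem _) (fun h h' => add_mem h h') (fun h => neg_mem h)
    (fun h => N.mul_mem_relationSpan_left _ h) (fun h => N.mul_mem_relationSpan_right h _)
  have hJ : ∀ y, y ∈ J ↔ y ∈ N.relationSpan := fun y => by
    simp [J, TwoSidedIdeal.mem_mk']
  have hle : TwoSidedIdeal.ker N.proj ≤ J := by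
    rw [N.ker_proj, TwoSidedIdeal.span_le]
    rintro _ ⟨p, hp, rfl⟩
    exact (hJ _).2 (Submodule.subset_span ⟨p, ⟨p, hp, 0, by simp, by simp⟩, rfl⟩)
  exact (hJ x).1 (hle ((TwoSidedIdeal.mem_ker _).2 hx))

theorem proj_relation_eq_zero {r : CyclicPath n} (hr : r ∈ N.relations) :
    N.proj (ofPath k r) = 0 := by
  rw [← TwoSidedIdeal.mem_ker, N.ker_proj]
  exact TwoSidedIdeal.subset_span ⟨r, hr, rfl⟩

/-- The class in `A` of the path of length `l` starting at `x`. -/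
noncomputable def path (x : ZMod n) (l : ℕ) : A := N.proj (ofPath k ⟨x, l⟩)

theorem path_mul_path (x y : ZMod n) (i j : ℕ) :
    N.path x i * N.path y j = if x + i = y then N.path x (i + j) else 0 := by
  rw [path, path, ← map_mul, ofPath_mul_ofPath]
  by_cases h : x + i = y
  · rw [if_pos h, if_pos (show CyclicPath.target ⟨x, i⟩ = y from h)]; rfl
  · rw [if_neg h, if_neg (show ¬ CyclicPath.target ⟨x, i⟩ = y from h), map_zero]

theorem idem_eq_path (x : ZMod n) : N.idem x = N.path x 0 := rfl

theorem span_path : Submodule.span k (Set.range fun q : ZMod n × ℕ => N.path q.1 q.2) = ⊤ := by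
  rw [eq_top_iff]
  rintro a -
  obtain ⟨x, rfl⟩ := N.proj_surjective a
  induction x using PathAlgebra.induction_on with
  | zero => simp
  | add a b ha hb => rw [map_add]; exact add_mem ha hb
  | smul_ofPath c p =>
    rw [map_smul]
    exact Submodule.smul_mem _ _ (Submodule.subset_span ⟨(p.source, p.length), rfl⟩)

variable {N} in
@[elab_as_elim]
theorem induction_path {P : A → Prop} (a : A) (path : ∀ x l, P (N.path x l)) (zero : P 0)
    (add : ∀ x y, P x → P y → P (x + y)) (smul : ∀ (c : k) (x : A), P x → P (c • x)) : P a := by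
  have ha : a ∈ Submodule.span k (Set.range fun q : ZMod n × ℕ => N.path q.1 q.2) := by
    rw [N.span_path]; trivial
  induction ha using Submodule.span_induction with
  | mem x hx => obtain ⟨q, rfl⟩ := hx; exact path _ _
  | zero => exact zero
  | add x y _ _ hx hy => exact add x y hx hy
  | smul c x _ hx => exact smul c x hx

variable {N} in
theorem ContainsRelation.path_eq_zero {x : ZMod n} {l : ℕ} (h : N.ContainsRelation ⟨x, l⟩) :
    N.path x l = 0 := by
  obtain ⟨r, hr, i, h1, h2⟩ := h
  simp only at h1 h2
  have e : N.path x l = N.path x i * (N.path (x + i) r.length *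
      N.path (x + i + r.length) (l - i - r.length)) := by
    rw [path_mul_path, if_pos rfl, path_mul_path, if_pos rfl]
    congr 1; omega
  have hz : N.path (x + i) r.length = 0 := by
    rw [path, ← h1]; exact N.proj_relation_eq_zero hr
  rw [e, hz, zero_mul, mul_zero]

/-- The kernel lies in the span of a set of basis paths disjoint from the set considered here, so
`proj` is injective on the span of the latter. -/
theorem linearIndependent_path :
    LinearIndependent k fun p : {p : CyclicPath n // ¬ N.ContainsRelation p} =>
      N.path p.1.source p.1.length := by
  have h0 : LinearIndependent k fun p : {p : CyclicPath n // ¬ N.ContainsRelation p} =>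
      pathBasis k n p.1 := (pathBasis k n).linearIndependent.comp _ Subtype.val_injective
  refine h0.map (f := N.proj.toLinearMap) ?_
  rw [Submodule.disjoint_def]
  intro x hx hx'
  have hx' := N.mem_relationSpan_of_proj_eq_zero hx'
  have h1 : N.relationSpan = Submodule.span k (pathBasis k n '' {p | N.ContainsRelation p}) := by
    unfold relationSpan; congr 1; ext y; simp [pathBasis_apply, eq_comm]
  have h2 : Set.range (fun p : {p : CyclicPath n // ¬ N.ContainsRelation p} => pathBasis k n p.1)
      = pathBasis k n '' {p | ¬ N.ContainsRelation p} := by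
    ext y; simp [pathBasis_apply]
  rw [h1] at hx'
  rw [h2] at hx
  have := (pathBasis k n).linearIndependent.disjoint_span_image
    (s := {p | ¬ N.ContainsRelation p}) (t := {p | N.ContainsRelation p})
    (by rw [Set.disjoint_left]; intro p h h'; exact h h')
  exact (Submodule.disjoint_def.1 this) x hx hx'

theorem span_linearIndependent_path :
    ⊤ ≤ Submodule.span k (Set.range fun p : {p : CyclicPath n // ¬ N.ContainsRelation p} =>
      N.path p.1.source p.1.length) := by
  rw [← N.span_path, Submodule.span_le]
  rintro _ ⟨⟨x, l⟩, rfl⟩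
  by_cases h : N.ContainsRelation ⟨x, l⟩
  · simp [h.path_eq_zero]
  · exact Submodule.subset_span ⟨⟨_, h⟩, rfl⟩

/-- The basis of `A` given by the paths that contain no relation. -/
noncomputable def basis : Module.Basis {p : CyclicPath n // ¬ N.ContainsRelation p} k A :=
  Module.Basis.mk N.linearIndependent_path N.span_linearIndependent_path

theorem path_ne_zero {x : ZMod n} {l : ℕ} (h : ¬ N.ContainsRelation ⟨x, l⟩) : N.path x l ≠ 0 := by
  simpa [basis] using N.basis.ne_zero ⟨_, h⟩

theorem path_eq_zero_iff {x : ZMod n} {l : ℕ} :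
    N.path x l = 0 ↔ N.ContainsRelation ⟨x, l⟩ :=
  ⟨fun h => by_contra fun h' => N.path_ne_zero h' h, fun h => h.path_eq_zero⟩

theorem path_zero_ne_zero (x : ZMod n) : N.path x 0 ≠ 0 := by
  rw [Ne, path_eq_zero_iff]
  rintro ⟨r, hr, i, -, h⟩
  have := N.nontrivial_relations r hr
  simp only at h; omega

theorem path_eq_zero_mono {x : ZMod n} {i j : ℕ} (h : N.path x i = 0) (hij : i ≤ j) :
    N.path x j = 0 := by
  have : N.path x j = N.path x i * N.path (x + i) (j - i) := by
    rw [path_mul_path, if_pos rfl]; congr 1; omega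
  rw [this, h, zero_mul]

theorem path_succ_eq_zero {x : ZMod n} {i : ℕ} (h : N.path (x + 1) i = 0) :
    N.path x (i + 1) = 0 := by
  have : N.path x (i + 1) = N.path x 1 * N.path (x + 1) i := by
    rw [path_mul_path, if_pos (by simp)]; congr 1; omega
  rw [this, h, mul_zero]

open Classical in
/-- The coefficient of the path of length `l` starting at `x`, which is `0` if that path
vanishes in `A`. -/
noncomputable def coeff (x : ZMod n) (l : ℕ) : A →ₗ[k] k :=
  if h : N.ContainsRelation ⟨x, l⟩ then 0 else N.basis.coord ⟨⟨x, l⟩, h⟩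

open Classical in
theorem coeff_path (x y : ZMod n) (l j : ℕ) :
    N.coeff x l (N.path y j) = if x = y ∧ l = j ∧ N.path x l ≠ 0 then 1 else 0 := by
  unfold coeff
  split_ifs with h1 h2 h2
  · exact absurd h1.path_eq_zero h2.2.2
  · rfl
  · obtain ⟨rfl, rfl, h⟩ := h2
    have : N.path x l = N.basis ⟨⟨x, l⟩, h1⟩ := by simp [basis]
    rw [this]; simp
  · by_cases h3 : N.ContainsRelation ⟨y, j⟩
    · simp [h3.path_eq_zero]
    · have : N.path y j = N.basis ⟨⟨y, j⟩, h3⟩ := by simp [basis]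
      rw [this, Module.Basis.coord_apply, Module.Basis.repr_self, Finsupp.single_apply, if_neg]
      simp only [Subtype.mk.injEq, CyclicPath.mk.injEq]
      rintro ⟨rfl, rfl⟩
      exact h2 ⟨rfl, rfl, N.path_ne_zero h1⟩

theorem coeff_eq_zero_of_path_eq_zero {x : ZMod n} {l : ℕ} (h : N.path x l = 0) :
    N.coeff x l = 0 := by
  unfold coeff; rw [dif_pos (N.path_eq_zero_iff.1 h)]

theorem eq_zero_of_coeff {a : A} (h : ∀ x l, N.coeff x l a = 0) : a = 0 := by
  refine N.basis.ext_elem fun p => ?_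
  have := h p.1.source p.1.length
  unfold coeff at this
  rw [dif_neg p.2] at this
  simpa using this

/-- Multiplication by a path shifts coefficients. The condition `N.path x l ≠ 0` cannot be dropped:
a zero path has coefficient `0`, while its final segment may survive. -/
theorem coeff_path_mul (x y : ZMod n) (l j : ℕ) (a : A) :
    N.coeff x l (N.path y j * a) =
      open Classical in if x = y ∧ j ≤ l ∧ N.path x l ≠ 0 then N.coeff (x + j) (l - j) a else 0 := by
  classical
  induction a using N.induction_path with
  | path z i =>
    rw [path_mul_path]
    by_cases h1 : x = y ∧ j ≤ l ∧ N.path x l ≠ 0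
    · rw [if_pos h1]
      obtain ⟨rfl, h2, h3⟩ := h1
      have h4 : N.path (x + j) (l - j) ≠ 0 := by
        intro h4
        apply h3
        have : N.path x l = N.path x j * N.path (x + j) (l - j) := by
          rw [path_mul_path, if_pos rfl]; congr 1; omega
        rw [this, h4, mul_zero]
      rw [coeff_path]
      by_cases h5 : x + j = z
      · rw [if_pos h5, coeff_path]
        have : (l = j + i) ↔ (l - j = i) := by omega
        subst h5
        simp [h3, h4, this]
      · simp [h5]
    · rw [if_neg h1]
      split_ifs
      · rw [coeff_path, if_neg]
        rintro ⟨rfl, rfl, h⟩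
        exact h1 ⟨rfl, by omega, h⟩
      · simp
  | zero => simp
  | add a b ha hb => rw [mul_add, map_add, ha, hb, map_add]; split_ifs <;> simp
  | smul c a ha => rw [mul_smul_comm, map_smul, ha, map_smul]; split_ifs <;> simp

theorem coeff_mul_path (x y : ZMod n) (l j : ℕ) (a : A) :
    N.coeff x l (a * N.path y j) =
      open Classical in
      if x + l = y + j ∧ j ≤ l ∧ N.path x l ≠ 0 then N.coeff x (l - j) a else 0 := by
  classical
  induction a using N.induction_path with
  | path z i =>
    rw [path_mul_path]
    by_cases h1 : x + l = y + j ∧ j ≤ l ∧ N.path x l ≠ 0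
    · rw [if_pos h1]
      obtain ⟨h1, h2, h3⟩ := h1
      have h4 : N.path x (l - j) ≠ 0 := fun h4 => h3 (N.path_eq_zero_mono h4 (by omega))
      rw [coeff_path]
      have hy : y = x + (l - j : ℕ) := by
        rw [Nat.cast_sub h2]; linear_combination -h1
      by_cases h5 : x = z ∧ l - j = i
      · obtain ⟨rfl, rfl⟩ := h5
        rw [if_pos hy.symm, coeff_path]
        have : l = l - j + j := by omega
        simp [h3, h4, ← this]
      · rw [if_neg (show ¬ (x = z ∧ l - j = i ∧ _) from fun h => h5 ⟨h.1, h.2.1⟩)]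
        split_ifs with h6
        · rw [coeff_path, if_neg]
          rintro ⟨hx, hl, -⟩
          exact h5 ⟨hx, by omega⟩
        · simp
    · rw [if_neg h1]
      split_ifs with h6
      · rw [coeff_path, if_neg]
        rintro ⟨rfl, rfl, h⟩
        refine h1 ⟨?_, by omega, h⟩
        rw [← h6]; push_cast; ring
      · simp
  | zero => simp
  | add a b ha hb => rw [add_mul, map_add, ha, hb, map_add]; split_ifs <;> simp
  | smul c a ha => rw [smul_mul_assoc, map_smul, ha, map_smul]; split_ifs <;> simp

theorem range_mulLeft_idem (x : ZMod n) :
    LinearMap.range (LinearMap.mulLeft k (N.idem x)) =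
      Submodule.span k (Set.range fun l => N.path x l) := by
  rw [← Submodule.map_top, ← N.span_path, Submodule.map_span, idem_eq_path]
  apply le_antisymm
  · rw [Submodule.span_le]
    rintro _ ⟨_, ⟨⟨y, l⟩, rfl⟩, rfl⟩
    simp only [LinearMap.mulLeft_apply, path_mul_path]
    split_ifs
    · exact Submodule.subset_span ⟨_, rfl⟩
    · exact zero_mem _
  · rw [Submodule.span_le]
    rintro _ ⟨l, rfl⟩
    refine Submodule.subset_span ⟨_, ⟨(x, l), rfl⟩, ?_⟩
    simp [path_mul_path]

theorem peirceGradedPart_eq (b a : ZMod n) (l : ℕ) :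
    N.peirceGradedPart b a l = if b + l = a then Submodule.span k {N.path b l} else ⊥ := by
  have key : ∀ p : CyclicPath n, p.length = l →
      N.idem b * (N.proj (ofPath k p) * N.idem a) =
        if p.source = b ∧ b + l = a then N.path b l else 0 := by
    rintro ⟨x, j⟩ hj
    obtain rfl : j = l := hj
    change N.path b 0 * (N.path x j * N.path a 0) = if x = b ∧ b + j = a then _ else _
    rw [path_mul_path]
    by_cases h1 : x = b
    · subst h1
      by_cases h2 : x + j = a
      · rw [if_pos h2, if_pos ⟨rfl, h2⟩, path_mul_path]; simp
      · rw [if_neg h2, if_neg (fun h => h2 h.2), mul_zero]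
    · rw [if_neg (show ¬ (x = b ∧ _) from fun h => h1 h.1)]
      split_ifs
      · rw [path_mul_path, if_neg]
        simpa using fun h => h1 h.symm
      · rw [mul_zero]
  rw [peirceGradedPart, gradedPart, Submodule.map_span]
  apply le_antisymm
  · rw [Submodule.span_le]
    rintro _ ⟨_, ⟨p, hp, rfl⟩, rfl⟩
    simp only [LinearMap.comp_apply, LinearMap.mulLeft_apply, LinearMap.mulRight_apply, key p hp]
    by_cases h : b + l = a
    · rw [if_pos h]
      split_ifs
      · exact Submodule.mem_span_singleton_self _
      · exact zero_mem _
    · simp [h]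
  · split_ifs with h
    · rw [Submodule.span_singleton_le_iff_mem]
      refine Submodule.subset_span ⟨_, ⟨⟨b, l⟩, rfl, rfl⟩, ?_⟩
      simp only [LinearMap.comp_apply, LinearMap.mulLeft_apply, LinearMap.mulRight_apply,
        key ⟨b, l⟩ rfl]
      simp [h]
    · exact bot_le

/-! ### The dimensions `p_a` and the entries of the graded Cartan matrix -/

variable [FiniteDimensional k A]

theorem exists_path_eq_zero (x : ZMod n) : ∃ l, N.path x l = 0 := by
  by_contra! h
  have hf : Finite {p : CyclicPath n // ¬ N.ContainsRelation p} :=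
    Module.Finite.finite_basis N.basis
  have : Function.Injective fun l : ℕ =>
      (⟨⟨x, l⟩, fun h' => h l h'.path_eq_zero⟩ : {p : CyclicPath n // ¬ N.ContainsRelation p}) := by
    intro l l' hl
    simpa using hl
  exact not_injective_infinite_finite _ this

/-- Once a path from `x` vanishes, all longer ones do; the paths before the first vanishing length
form a basis of `e_x A`. -/
theorem path_eq_zero_iff_projDim_le {x : ZMod n} {l : ℕ} :
    N.path x l = 0 ↔ N.projDim x ≤ l := by
  classical
  let d := Nat.find (N.exists_path_eq_zero x)
  have hd : N.path x d = 0 := Nat.find_spec (N.exists_path_eq_zero x)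
  have hlt : ∀ l < d, N.path x l ≠ 0 := fun l hl => Nat.find_min (N.exists_path_eq_zero x) hl
  have hli : LinearIndependent k fun i : Fin d => N.path x i := by
    refine N.linearIndependent_path.comp (fun i : Fin d =>
      (⟨⟨x, i⟩, fun h' => hlt i i.2 h'.path_eq_zero⟩ :
        {p : CyclicPath n // ¬ N.ContainsRelation p})) ?_
    intro i j hij
    simpa [Fin.ext_iff] using hij
  have hdim : N.projDim x = d := by
    rw [projDim, range_mulLeft_idem]
    have : Submodule.span k (Set.range fun l => N.path x l) =
        Submodule.span k (Set.range fun i : Fin d => N.path x i) := by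
      apply le_antisymm
      · rw [Submodule.span_le]
        rintro _ ⟨l, rfl⟩
        by_cases hl : l < d
        · exact Submodule.subset_span ⟨⟨l, hl⟩, rfl⟩
        · simp [N.path_eq_zero_mono hd (not_lt.1 hl)]
      · apply Submodule.span_mono
        rintro _ ⟨i, rfl⟩
        exact ⟨i, rfl⟩
    rw [this, finrank_span_eq_card hli, Fintype.card_fin]
  rw [hdim]
  exact ⟨fun h => not_lt.1 fun h' => hlt l h' h, fun h => N.path_eq_zero_mono hd h⟩

theorem path_ne_zero_iff_lt_projDim {x : ZMod n} {l : ℕ} :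
    N.path x l ≠ 0 ↔ l < N.projDim x := by
  rw [Ne, path_eq_zero_iff_projDim_le, not_le]

theorem projDim_pos (x : ZMod n) : 0 < N.projDim x :=
  N.path_ne_zero_iff_lt_projDim.1 (N.path_zero_ne_zero x)

/-- A zero path stays zero when an arrow is put in front. This inequality is what makes `gammaLift`
monotone. -/
theorem projDim_le_projDim_add_one (x : ZMod n) : N.projDim x ≤ N.projDim (x + 1) + 1 :=
  N.path_eq_zero_iff_projDim_le.1
    (N.path_succ_eq_zero (N.path_eq_zero_iff_projDim_le.2 le_rfl))

theorem finrank_peirceGradedPart (b a : ZMod n) (l : ℕ) :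
    Module.finrank k (N.peirceGradedPart b a l) =
      if b + l = a ∧ l < N.projDim b then 1 else 0 := by
  rw [peirceGradedPart_eq]
  by_cases h : b + l = a
  · rw [if_pos h]
    by_cases h' : l < N.projDim b
    · rw [if_pos ⟨h, h'⟩, finrank_span_singleton (N.path_ne_zero_iff_lt_projDim.2 h')]
    · rw [if_neg (fun h2 => h' h2.2), N.path_eq_zero_iff_projDim_le.2 (not_lt.1 h')]
      simp
  · rw [if_neg h, if_neg (fun h2 => h h2.1), finrank_bot]

theorem gradedCartan_apply (a b : ZMod n) :
    N.gradedCartan a b =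
      ∑ l ∈ Finset.range (N.projDim b), if b + l = a then Polynomial.X ^ l else 0 := by
  rw [gradedCartan, Matrix.of_apply, finsum_eq_sum_of_support_subset (s := Finset.range (N.projDim b))]
  · refine Finset.sum_congr rfl fun l hl => ?_
    rw [finrank_peirceGradedPart]
    simp only [Finset.mem_range] at hl
    by_cases h : b + l = a <;> simp [h, hl, Polynomial.X_pow_eq_monomial]
  · intro l hl
    simp only [Function.mem_support, finrank_peirceGradedPart] at hl
    by_contra h
    apply hl
    rw [if_neg (fun h2 => h (by simpa using h2.2))]
    simp

theorem gradedCartanRat_apply (a b : ZMod n) :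
    N.gradedCartanRat a b =
      ∑ l ∈ Finset.range (N.projDim b), if b + l = a then (RatFunc.X : RatFunc ℚ) ^ l else 0 := by
  simp only [gradedCartanRat, Matrix.map_apply, gradedCartan_apply, Polynomial.map_sum, map_sum]
  refine Finset.sum_congr rfl fun l _ => ?_
  split_ifs <;> simp [RatFunc.algebraMap_X]

end

end NakayamaPresentation

/-! ### Uniserial right modules, their injective envelopes and the simple tops -/

namespace NakayamaPresentation

section

open MulOpposite

variable {k : Type u} [Field k] {n : ℕ} [NeZero n] {A : Type v} [Ring A] [Algebra k A]
  (N : NakayamaPresentation k n A)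

/-- The right ideal of the elements in which the paths from `x` of length less than `L` do not
occur. The quotient of `A` by it is the uniserial module of length `L` with top `S_x`. -/
noncomputable def coeffIdeal (x : ZMod n) (L : ℕ) : Submodule Aᵐᵒᵖ A where
  carrier := {a | ∀ l < L, N.coeff x l a = 0}
  zero_mem' l _ := map_zero _
  add_mem' ha hb l hl := by rw [map_add, ha l hl, hb l hl, add_zero]
  smul_mem' b a ha l hl := by
    classical
    obtain ⟨b, rfl⟩ := op_surjective b
    rw [op_smul_eq_mul]
    induction b using N.induction_path generalizing l with
    | path y j =>
      rw [coeff_mul_path]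
      split_ifs
      · exact ha _ (by omega)
      · rfl
    | zero => simp
    | add b c hb hc => rw [mul_add, map_add, hb l hl, hc l hl, add_zero]
    | smul c b hb => rw [mul_smul_comm, map_smul, hb l hl, smul_zero]

theorem mem_coeffIdeal {x : ZMod n} {L : ℕ} {a : A} :
    a ∈ N.coeffIdeal x L ↔ ∀ l < L, N.coeff x l a = 0 := Iff.rfl

theorem coeffIdeal_anti (x : ZMod n) {L M : ℕ} (h : L ≤ M) :
    N.coeffIdeal x M ≤ N.coeffIdeal x L := fun _ ha l hl => ha l (by omega)

/-- Left multiplication by `b` as a map of right modules. -/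
noncomputable def leftMul (b : A) : A →ₗ[Aᵐᵒᵖ] A where
  toFun a := b * a
  map_add' := mul_add b
  map_smul' c a := by simp [← mul_assoc, MulOpposite.smul_eq_mul_unop]

/-- The uniserial right module of length `L` (if `L ≤ p_x`) with top `S_x`. -/
abbrev uniserial (x : ZMod n) (L : ℕ) : Type v := A ⧸ N.coeffIdeal x L

variable {N} in
theorem path_mul_mem_coeffIdeal_iff {x : ZMod n} {i L : ℕ}
    (h : ∀ l < i + L, N.path x l ≠ 0) {a : A} :
    N.path x i * a ∈ N.coeffIdeal x (i + L) ↔ a ∈ N.coeffIdeal (x + i) L := by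
  classical
  simp only [mem_coeffIdeal, coeff_path_mul, true_and]
  constructor
  · intro H l hl
    have := H (i + l) (by omega)
    rwa [if_pos ⟨by omega, h _ (by omega)⟩, Nat.add_sub_cancel_left] at this
  · intro H l hl
    split_ifs
    · exact H _ (by omega)
    · rfl

theorem sub_sum_mem_coeffIdeal (x : ZMod n) (L : ℕ) (a : A) :
    a - ∑ l ∈ Finset.range L, N.coeff x l a • N.path x l ∈ N.coeffIdeal x L := by
  classical
  intro l hl
  rw [map_sub, map_sum, Finset.sum_eq_single l]
  · rw [map_smul, coeff_path, smul_eq_mul]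
    by_cases h : N.path x l = 0
    · simp [N.coeff_eq_zero_of_path_eq_zero h]
    · simp [h]
  · intro j _ hj
    rw [map_smul, coeff_path, if_neg (fun h => hj h.2.1.symm), smul_zero]
  · intro h
    exact absurd (Finset.mem_range.2 hl) h

/-- The inclusion of uniserial modules given by left multiplication with a path. -/
noncomputable def uniserialInclusion {x : ZMod n} {i L : ℕ} (h : ∀ l < i + L, N.path x l ≠ 0) :
    N.uniserial (x + i) L →ₗ[Aᵐᵒᵖ] N.uniserial x (i + L) :=
  Submodule.mapQ _ _ (leftMul (N.path x i)) fun _ ha => (path_mul_mem_coeffIdeal_iff h).2 ha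

theorem uniserialInclusion_mk {x : ZMod n} {i L : ℕ} (h : ∀ l < i + L, N.path x l ≠ 0) (a : A) :
    N.uniserialInclusion h (Submodule.Quotient.mk a) = Submodule.Quotient.mk (N.path x i * a) :=
  rfl

theorem uniserialInclusion_injective {x : ZMod n} {i L : ℕ}
    (h : ∀ l < i + L, N.path x l ≠ 0) : Function.Injective (N.uniserialInclusion h) := by
  rw [injective_iff_map_eq_zero]
  intro m hm
  obtain ⟨a, rfl⟩ := Submodule.Quotient.mk_surjective _ m
  rw [uniserialInclusion_mk, Submodule.Quotient.mk_eq_zero, path_mul_mem_coeffIdeal_iff h] at hm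
  exact (Submodule.Quotient.mk_eq_zero _).2 hm

/-- The projection of a uniserial module onto a shorter one. -/
noncomputable def uniserialProjection (x : ZMod n) (i L : ℕ) :
    N.uniserial x (i + L) →ₗ[Aᵐᵒᵖ] N.uniserial x i :=
  Submodule.factor (N.coeffIdeal_anti x (Nat.le_add_right i L))

theorem uniserialProjection_mk (x : ZMod n) (i L : ℕ) (a : A) :
    N.uniserialProjection x i L (Submodule.Quotient.mk a) = Submodule.Quotient.mk a := rfl

theorem uniserial_exact {x : ZMod n} {i L : ℕ} (h : ∀ l < i + L, N.path x l ≠ 0) :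
    Function.Exact (N.uniserialInclusion h) (N.uniserialProjection x i L) := by
  classical
  intro m
  obtain ⟨a, rfl⟩ := Submodule.Quotient.mk_surjective _ m
  rw [uniserialProjection_mk, Submodule.Quotient.mk_eq_zero]
  constructor
  · intro ha
    refine ⟨Submodule.Quotient.mk (∑ j ∈ Finset.range L, N.coeff x (i + j) a • N.path (x + i) j),
      ?_⟩
    rw [uniserialInclusion_mk, eq_comm, Submodule.Quotient.eq]
    have := N.sub_sum_mem_coeffIdeal x (i + L) a
    rw [Finset.sum_range_add, Finset.sum_eq_zero, zero_add] at this
    · convert this using 2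
      rw [Finset.mul_sum]
      refine Finset.sum_congr rfl fun j _ => ?_
      rw [mul_smul_comm, path_mul_path, if_pos rfl]
    · intro l hl
      rw [ha l (Finset.mem_range.1 hl), zero_smul]
  · rintro ⟨m', hm'⟩
    obtain ⟨b, rfl⟩ := Submodule.Quotient.mk_surjective _ m'
    rw [uniserialInclusion_mk, Submodule.Quotient.eq] at hm'
    have h1 := N.coeffIdeal_anti x (Nat.le_add_right i L) hm'
    have h2 : N.path x i * b ∈ N.coeffIdeal x i := by
      intro l hl
      rw [coeff_path_mul, if_neg (by omega)]
    simpa using sub_mem h2 h1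

theorem coeff_eq_of_mk_eq {x : ZMod n} {L l : ℕ} (hl : l < L) {a b : A}
    (h : (Submodule.Quotient.mk a : N.uniserial x L) = Submodule.Quotient.mk b) :
    N.coeff x l a = N.coeff x l b := by
  rw [Submodule.Quotient.eq] at h
  have := h l hl
  rwa [map_sub, sub_eq_zero] at this

/-- This is the duality behind injectivity: the uniserial module is the `k`-dual of `A e_{x+L}`,
because by `h'` the nonzero paths ending at `x + L` are exactly the final segments of the path of
length `L` from `x`. -/
theorem exists_coeff_mul_eq {x : ZMod n} {L : ℕ} (h : ∀ l < L + 1, N.path x l ≠ 0)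
    (h' : N.path (x - 1) (L + 1) = 0) (f : A →ₗ[k] k) :
    ∃ m : A, ∀ b, N.coeff x L (m * b) = f (b * N.path (x + L) 0) := by
  classical
  refine ⟨∑ i ∈ Finset.range (L + 1), f (N.path (x + i) (L - i)) • N.path x i, fun b => ?_⟩
  set m := ∑ i ∈ Finset.range (L + 1), f (N.path (x + i) (L - i)) • N.path x i with hm
  have hc : ∀ i ≤ L, N.coeff x i m = f (N.path (x + i) (L - i)) := by
    intro i hi
    rw [hm, map_sum, Finset.sum_eq_single i]
    · rw [map_smul, coeff_path, if_pos ⟨rfl, rfl, h i (by omega)⟩, smul_eq_mul, mul_one]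
    · intro j _ hj
      rw [map_smul, coeff_path, if_neg (fun h => hj h.2.1.symm), smul_zero]
    · intro hi'
      exact absurd (Finset.mem_range.2 (by omega)) hi'
  induction b using N.induction_path with
  | path z j =>
    rw [coeff_mul_path, path_mul_path]
    by_cases hz : z + j = x + L
    · rw [if_pos hz]
      by_cases hj : j ≤ L
      · rw [if_pos ⟨hz.symm, hj, h L (by omega)⟩, hc _ (by omega)]
        have h1 : L - (L - j) = j := by omega
        have h2 : x + ((L - j : ℕ) : ZMod n) = z := by
          rw [Nat.cast_sub hj]; linear_combination -hz
        rw [h1, h2, add_zero]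
      · rw [if_neg (by omega), add_zero]
        -- A path of length greater than `L` ending at `x + L` has the zero path of `h'` as its
        -- final segment.
        have h3 : N.path z j = N.path z (j - (L + 1)) * N.path (x - 1) (L + 1) := by
          rw [path_mul_path, if_pos]
          · congr 1; omega
          · rw [Nat.cast_sub (by omega)]; push_cast; linear_combination hz
        rw [h3, h', mul_zero, map_zero]
    · rw [if_neg hz, if_neg (fun h => hz h.1.symm), map_zero]
  | zero => simp
  | add a b ha hb => rw [mul_add, map_add, ha, hb, add_mul, map_add]
  | smul c a ha => rw [mul_smul_comm, map_smul, ha, smul_mul_assoc, map_smul]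

/-- Composing `φ` with the socle coefficient, the one of index `L`, gives a functional on the ideal.
It extends `k`-linearly to `A`, and the duality turns the extension into an element `m` of the
module. -/
theorem uniserial_baer {x : ZMod n} {L : ℕ} (h : ∀ l < L + 1, N.path x l ≠ 0)
    (h' : N.path (x - 1) (L + 1) = 0) : Module.Baer Aᵐᵒᵖ (N.uniserial x (L + 1)) := by
  intro I φ
  have hex : ∀ i : I, ∃ a : A, (Submodule.Quotient.mk a : N.uniserial x (L + 1)) = φ i :=
    fun i => Submodule.Quotient.mk_surjective _ _
  choose r hr using hex
  let S : Submodule k A :=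
    { carrier := {a | op a ∈ I}
      zero_mem' := by simp
      add_mem' := fun ha hb => by
        simp only [Set.mem_ofPred_eq, op_add] at *
        exact add_mem ha hb
      smul_mem' := fun c a ha => by
        simp only [Set.mem_ofPred_eq] at *
        have : op (c • a) = op (algebraMap k A c) * op a := by
          rw [← op_mul, Algebra.smul_def, Algebra.commutes]
        rw [this]
        exact I.mul_mem_left _ ha }
  let f₀ : S →ₗ[k] k :=
    { toFun := fun a => N.coeff x L (r ⟨op a.1, a.2⟩)
      map_add' := fun a b => by
        rw [← map_add]
        refine N.coeff_eq_of_mk_eq (Nat.lt_succ_self L) ?_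
        rw [hr, Submodule.Quotient.mk_add, hr, hr, ← map_add]
        rfl
      map_smul' := fun c a => by
        rw [RingHom.id_apply, ← map_smul]
        refine N.coeff_eq_of_mk_eq (Nat.lt_succ_self L) ?_
        have h1 : c • r ⟨op a.1, a.2⟩ = op (algebraMap k A c) • r ⟨op a.1, a.2⟩ := by
          rw [op_smul_eq_mul, Algebra.smul_def, Algebra.commutes]
        rw [hr, h1, Submodule.Quotient.mk_smul, hr, ← map_smul]
        congr 1
        ext
        simp [Algebra.smul_def, Algebra.commutes] }
  obtain ⟨f, hf⟩ := LinearMap.exists_extend f₀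
  have hf' : ∀ a (ha : op a ∈ I), f a = N.coeff x L (r ⟨op a, ha⟩) := fun a ha => by
    have := LinearMap.congr_fun hf ⟨a, ha⟩
    exact this
  obtain ⟨m, hm⟩ := N.exists_coeff_mul_eq h h' f
  refine ⟨LinearMap.toSpanSingleton Aᵐᵒᵖ _ (Submodule.Quotient.mk m), fun a ha => ?_⟩
  obtain ⟨a, rfl⟩ := op_surjective a
  rw [LinearMap.toSpanSingleton_apply, ← Submodule.Quotient.mk_smul, op_smul_eq_mul, ← hr,
    Submodule.Quotient.eq]
  intro l hl
  have hb : N.path (x + l) (L - l) * N.path (x + L) 0 = N.path (x + l) (L - l) := by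
    rw [path_mul_path, if_pos, add_zero]
    rw [Nat.cast_sub (by omega)]; ring
  -- Every coefficient can be pushed into the socle, so agreement there, on the whole ideal,
  -- suffices.
  have hs : ∀ u, N.coeff x L (u * N.path (x + l) (L - l)) = N.coeff x l u := by
    intro u
    have h1 : x + (L : ZMod n) = x + l + ((L - l : ℕ) : ZMod n) := by
      rw [Nat.cast_sub (by omega)]; ring
    have h2 : L - (L - l) = l := by omega
    rw [coeff_mul_path, if_pos ⟨h1, by omega, h L (by omega)⟩, h2]
  have hmem : op (a * N.path (x + l) (L - l)) ∈ I := by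
    rw [op_mul]; exact I.mul_mem_left _ ha
  rw [map_sub, sub_eq_zero, ← hs, ← hs (r _), mul_assoc, hm, mul_assoc, hb, hf' _ hmem]
  refine N.coeff_eq_of_mk_eq (Nat.lt_succ_self L) ?_
  have h1 : r ⟨op a, ha⟩ * N.path (x + l) (L - l) =
      op (N.path (x + l) (L - l)) • r ⟨op a, ha⟩ := (op_smul_eq_mul ..).symm
  rw [hr, h1, Submodule.Quotient.mk_smul, hr, ← map_smul]
  congr 1

/-- A retraction `ρ` of the inclusion into the longer module cannot exist. The last path is the
generator times a path of length `i + L - 1`, so its image under `ρ` has no coefficient of index `L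
- 1`; yet `ρ` should give the last path of the shorter module. -/
theorem not_injective_uniserial {x : ZMod n} {i L : ℕ} (h : ∀ l < i + L, N.path x l ≠ 0)
    (hi : 1 ≤ i) (hL : 1 ≤ L) : ¬ Module.Injective Aᵐᵒᵖ (N.uniserial (x + i) L) := by
  intro inj
  obtain ⟨ρ, hρ⟩ := inj.out (N.uniserialInclusion h) (N.uniserialInclusion_injective h)
    LinearMap.id
  obtain ⟨c, hc⟩ := Submodule.Quotient.mk_surjective _
    (ρ (Submodule.Quotient.mk (1 : A) : N.uniserial x (i + L)))
  have h1 := hρ (Submodule.Quotient.mk (N.path (x + i) (L - 1)))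
  have h2 : N.path x i * N.path (x + i) (L - 1) = N.path x (i + L - 1) := by
    rw [path_mul_path, if_pos rfl]; congr 1; omega
  have h3 : (Submodule.Quotient.mk (N.path x (i + L - 1)) : N.uniserial x (i + L)) =
      op (N.path x (i + L - 1)) • Submodule.Quotient.mk (1 : A) := by
    rw [← Submodule.Quotient.mk_smul, op_smul_eq_mul, one_mul]
  rw [uniserialInclusion_mk, h2, h3, map_smul, ← hc, ← Submodule.Quotient.mk_smul,
    op_smul_eq_mul, LinearMap.id_apply] at h1
  have h5 : N.path (x + i) (L - 1) ≠ 0 := by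
    intro h5
    rw [h5, mul_zero] at h2
    exact h (i + L - 1) (by omega) h2.symm
  have h4 := N.coeff_eq_of_mk_eq (show L - 1 < L by omega) h1
  rw [coeff_mul_path, if_neg (by omega), coeff_path, if_pos ⟨rfl, rfl, h5⟩] at h4
  exact zero_ne_one h4

theorem subsingleton_uniserial_iff {x : ZMod n} {L : ℕ} (h : ∀ l < L, N.path x l ≠ 0) :
    Subsingleton (N.uniserial x L) ↔ L = 0 := by
  rw [Submodule.Quotient.subsingleton_iff]
  constructor
  · intro H
    by_contra hL
    have h1 : N.path x 0 ∈ N.coeffIdeal x L := by rw [H]; trivial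
    have h2 := h1 0 (by omega)
    rw [coeff_path, if_pos ⟨rfl, rfl, h 0 (by omega)⟩] at h2
    exact one_ne_zero h2
  · rintro rfl
    rw [eq_top_iff]
    intro a _ l hl
    omega

open CategoryTheory

/-- The short exact sequence given by the inclusion of a submodule of a uniserial module. -/
noncomputable def uniserialSequence {x : ZMod n} {i L : ℕ} (h : ∀ l < i + L, N.path x l ≠ 0) :
    ShortComplex (ModuleCat.{v} Aᵐᵒᵖ) :=
  ShortComplex.mk (ModuleCat.ofHom (N.uniserialInclusion h))
    (ModuleCat.ofHom (N.uniserialProjection x i L)) (by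
      ext1
      refine LinearMap.ext fun m => ?_
      exact (N.uniserial_exact h).apply_apply_eq_zero m)

theorem uniserialSequence_shortExact {x : ZMod n} {i L : ℕ}
    (h : ∀ l < i + L, N.path x l ≠ 0) : (N.uniserialSequence h).ShortExact :=
  ModuleCat.shortComplex_shortExact _ (N.uniserial_exact h) (N.uniserialInclusion_injective h)
    (Submodule.factor_surjective (N.coeffIdeal_anti x (Nat.le_add_right i L)))

/-- Dimension shifting along the injective envelope of a uniserial module. -/
theorem hasInjectiveDimensionLT_uniserial_succ {x : ZMod n} {i L : ℕ}
    (h : ∀ l < i + L, N.path x l ≠ 0) (hL : 1 ≤ L) (h' : N.path (x - 1) (i + L) = 0) (d : ℕ) :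
    HasInjectiveDimensionLT (ModuleCat.of Aᵐᵒᵖ (N.uniserial (x + i) L)) (d + 1) ↔
      HasInjectiveDimensionLT (ModuleCat.of Aᵐᵒᵖ (N.uniserial x i)) d := by
  have hinj : Module.Injective Aᵐᵒᵖ (N.uniserial x (i + L)) := by
    obtain ⟨M, hM⟩ : ∃ M, i + L = M + 1 := ⟨i + L - 1, by omega⟩
    rw [hM] at h h' ⊢
    exact (N.uniserial_baer h h').injective
  cases d with
  | zero =>
    -- For `d = 0` the claim is that the submodule is injective exactly when the quotient vanishes.
    rw [zero_add, hasInjectiveDimensionLT_zero_iff_isZero, ModuleCat.isZero_of_iff_subsingleton,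
      N.subsingleton_uniserial_iff (fun l hl => h l (by omega)),
      ← injective_iff_hasInjectiveDimensionLT_one, ← Module.injective_iff_injective_object]
    constructor
    · intro H
      by_contra hi
      exact N.not_injective_uniserial h (by omega) hL H
    · rintro rfl
      have key : ∀ y M, y = x → M = 0 + L → Module.Injective Aᵐᵒᵖ (N.uniserial y M) := by
        rintro _ _ rfl rfl; exact hinj
      exact key _ _ (by simp) (by simp)
  | succ d =>
    exact ((N.uniserialSequence_shortExact h).hasInjectiveDimensionLT_X₃_iff d
      (Module.injective_object_of_injective_module _ _)).symm

theorem mem_projModule {a : ZMod n} {u : A} : u ∈ N.projModule a ↔ N.path a 0 * u = u := by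
  rw [projModule, Submodule.mem_span_singleton, idem_eq_path]
  constructor
  · rintro ⟨b, rfl⟩
    obtain ⟨b, rfl⟩ := op_surjective b
    rw [op_smul_eq_mul, ← mul_assoc, path_mul_path]
    simp
  · intro h
    exact ⟨op u, h⟩

/-- A submodule of `P_a` that is not contained in the radical is everything. -/
theorem eq_top_of_coeff_ne_zero [FiniteDimensional k A] {a : ZMod n}
    (T : Submodule Aᵐᵒᵖ (N.projModule a)) {q : N.projModule a} (hq : q ∈ T)
    (hq0 : N.coeff a 0 (q : A) ≠ 0) : T = ⊤ := by
  classical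
  have key : ∀ j l : ℕ, l + j = N.projDim a → ∀ u : N.projModule a,
      (u : A) ∈ N.coeffIdeal a l → u ∈ T := by
    intro j
    induction j with
    | zero =>
      intro l hl u hu
      have : u = 0 := by
        ext
        refine N.eq_zero_of_coeff fun y l' => ?_
        rw [← N.mem_projModule.1 u.2, coeff_path_mul]
        split_ifs with h
        · have h1 := hu l' (by
            rw [← h.1] at hl
            have := N.path_ne_zero_iff_lt_projDim.1 h.2.2
            omega)
          simpa [h.1] using h1
        · rfl
      rw [this]; exact zero_mem _
    | succ j ih =>
      intro l hl u hu
      have hl' : l < N.projDim a := by omega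
      have hp := N.path_ne_zero_iff_lt_projDim.2 hl'
      -- With this scalar, `c` times `q` times the path of length `l` cancels the coefficient of `u`
      -- at `l`, which moves `u` one step down the radical filtration.
      let c : k := N.coeff a l (u : A) * (N.coeff a 0 (q : A))⁻¹
      have hc : op (c • N.path a l) • q ∈ T := T.smul_mem _ hq
      have h1 : u - op (c • N.path a l) • q ∈ T := by
        refine ih (l + 1) (by omega) _ fun l' hl2 => ?_
        have e : ((u - op (c • N.path a l) • q : N.projModule a) : A) =
            u - c • ((q : A) * N.path a l) := by
          rw [Submodule.coe_sub, Submodule.coe_smul, op_smul_eq_mul, mul_smul_comm]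
        rw [e, map_sub, map_smul, coeff_mul_path]
        rcases Nat.lt_succ_iff_lt_or_eq.1 hl2 with h | rfl
        · rw [hu l' h, if_neg (by omega)]; simp
        · rw [if_pos ⟨rfl, le_rfl, hp⟩, Nat.sub_self, smul_eq_mul, inv_mul_cancel_right₀ hq0,
            sub_self]
      simpa using add_mem h1 hc
  rw [eq_top_iff]
  intro u _
  exact key (N.projDim a) 0 (by omega) u (fun l hl => by omega)

/-- The map from `P_a` onto its top, realised as a uniserial module of length one. -/
noncomputable def projModuleToTop (a : ZMod n) : N.projModule a →ₗ[Aᵐᵒᵖ] N.uniserial a 1 :=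
  (Submodule.mkQ _).comp (N.projModule a).subtype

theorem mem_ker_projModuleToTop {a : ZMod n} {u : N.projModule a} :
    u ∈ LinearMap.ker (N.projModuleToTop a) ↔ N.coeff a 0 (u : A) = 0 := by
  simp [projModuleToTop, mem_coeffIdeal]

theorem projModuleToTop_surjective (a : ZMod n) :
    Function.Surjective (N.projModuleToTop a) := by
  classical
  intro m
  obtain ⟨b, rfl⟩ := Submodule.Quotient.mk_surjective _ m
  refine ⟨⟨N.path a 0 * b, N.mem_projModule.2 ?_⟩, ?_⟩
  · rw [← mul_assoc, path_mul_path]; simp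
  · change Submodule.Quotient.mk (N.path a 0 * b) = _
    rw [Submodule.Quotient.eq]
    intro l hl
    obtain rfl : l = 0 := by omega
    rw [map_sub, coeff_path_mul, if_pos ⟨rfl, le_rfl, N.path_zero_ne_zero a⟩]
    simp

/-- The kernel is proper and contains every proper submodule, so it is the only maximal one. -/
theorem jacobson_projModule [FiniteDimensional k A] (a : ZMod n) :
    Module.jacobson Aᵐᵒᵖ (N.projModule a) = LinearMap.ker (N.projModuleToTop a) := by
  classical
  have htop : LinearMap.ker (N.projModuleToTop a) ≠ ⊤ := by
    intro h
    have h1 : (⟨N.path a 0, N.mem_projModule.2 (by rw [path_mul_path]; simp)⟩ : N.projModule a) ∈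
      LinearMap.ker (N.projModuleToTop a) := by rw [h]; trivial
    rw [mem_ker_projModuleToTop, coeff_path, if_pos ⟨rfl, rfl, N.path_zero_ne_zero a⟩] at h1
    exact one_ne_zero h1
  have hle : ∀ T : Submodule Aᵐᵒᵖ (N.projModule a), T ≠ ⊤ →
      T ≤ LinearMap.ker (N.projModuleToTop a) := by
    intro T hT q hq
    rw [mem_ker_projModuleToTop]
    by_contra h
    exact hT (N.eq_top_of_coeff_ne_zero T hq h)
  apply le_antisymm
  · refine sInf_le ⟨htop, fun T hT => ?_⟩
    by_contra h
    exact absurd (hle T h) (not_le_of_gt hT)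
  · refine le_sInf fun T hT => ?_
    rcases eq_or_lt_of_le (hle T hT.1) with h | h
    · exact h.ge
    · exact absurd (hT.2 _ h) htop

/-- The simple module `S_a` is the uniserial module of length one. -/
noncomputable def simpleModuleEquiv [FiniteDimensional k A] (a : ZMod n) :
    N.simpleModule a ≃ₗ[Aᵐᵒᵖ] N.uniserial a 1 :=
  (Submodule.quotEquivOfEq _ _ (N.jacobson_projModule a)).trans
    ((N.projModuleToTop a).quotKerEquivOfSurjective (N.projModuleToTop_surjective a))

theorem simpleInjDim_eq [FiniteDimensional k A] (a : ZMod n) :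
    N.simpleInjDim a = injectiveDimension (ModuleCat.of Aᵐᵒᵖ (N.uniserial a 1)) :=
  injectiveDimension_eq_of_iso (N.simpleModuleEquiv a).toModuleIso

end

end NakayamaPresentation

/-! ### Periodic points of monotone degree one maps of the integers -/

section DegreeOne

variable {f : ℤ → ℤ} {n : ℤ}

theorem iterate_add_mul_of_degree_one (hf : ∀ x, f (x + n) = f x + n) (m : ℕ) (x t : ℤ) :
    f^[m] (x + n * t) = f^[m] x + n * t := by
  have h1 : ∀ x, f (x + n * t) = f x + n * t := by
    intro x
    induction t using Int.induction_on with
    | zero => simp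
    | succ i ih => rw [mul_add, ← add_assoc, mul_one, hf, ih, add_assoc]
    | pred i ih =>
      have := hf (x + n * (-i - 1))
      rw [add_assoc, show n * (-(i : ℤ) - 1) + n = n * -i by ring, ih] at this
      linarith
  induction m generalizing x with
  | zero => rfl
  | succ m ih => rw [Function.iterate_succ_apply, h1, ih, Function.iterate_succ_apply]

theorem iterate_mul_of_degree_one (hf : ∀ x, f (x + n) = f x + n) {m : ℕ} {x v : ℤ}
    (h : f^[m] x = x + n * v) (K : ℕ) : f^[m * K] x = x + n * (v * K) := by
  induction K with
  | zero => simp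
  | succ K ih =>
    rw [Nat.mul_succ, Nat.add_comm, Function.iterate_add_apply, ih,
      iterate_add_mul_of_degree_one hf, h]
    push_cast; ring

/-- Monotone iteration preserves the inequality between `x` and a fixed translate of `y`, whereas
unequal mean displacements would separate the orbits linearly. -/
theorem displacement_le_of_degree_one (hmono : Monotone f) (hf : ∀ x, f (x + n) = f x + n)
    (hn : 0 < n) {m m' : ℕ} {x y v v' : ℤ} (hx : f^[m] x = x + n * v)
    (hy : f^[m'] y = y + n * v') : v * m' ≤ v' * m := by
  by_contra! hlt
  set c : ℤ := |x - y| with hc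
  have hc0 : 0 ≤ c := abs_nonneg _
  have hle : x ≤ y + n * c := by nlinarith [le_abs_self (x - y)]
  -- The two translations cost at most `2 * c` periods in total, so `2 * c + 1` repetitions of a
  -- gain of at least one are too many.
  let K : ℕ := (2 * c + 1).toNat
  have hK : (K : ℤ) = 2 * c + 1 := Int.toNat_of_nonneg (by omega)
  have h1 := iterate_mul_of_degree_one hf hx (m' * K)
  have h2 := iterate_mul_of_degree_one hf hy (m * K)
  have h3 := hmono.iterate (m * (m' * K)) hle
  rw [iterate_add_mul_of_degree_one hf, h1, show m * (m' * K) = m' * (m * K) by ring, h2] at h3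
  push_cast at h3
  have h4 : n * (K * (v * m' - v' * m)) ≤ n * (2 * c) := by
    nlinarith [neg_abs_le (x - y)]
  have h5 := le_of_mul_le_mul_left h4 hn
  rw [hK] at h5
  nlinarith

theorem displacement_eq_of_degree_one (hmono : Monotone f) (hf : ∀ x, f (x + n) = f x + n)
    (hn : 0 < n) {m m' : ℕ} {x y v v' : ℤ} (hx : f^[m] x = x + n * v)
    (hy : f^[m'] y = y + n * v') : v * m' = v' * m :=
  le_antisymm (displacement_le_of_degree_one hmono hf hn hx hy)
    (displacement_le_of_degree_one hmono hf hn hy hx)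

/-- A strict inequality between `f^[m'] x` and the translate would persist under repetition. After
`m` repetitions the equality of mean displacements rules it out. -/
theorem iterate_eq_of_degree_one (hmono : Monotone f) (hf : ∀ x, f (x + n) = f x + n)
    (hn : 0 < n) {m m' : ℕ} (hm : 0 < m) {x y v v' : ℤ} (hx : f^[m] x = x + n * v)
    (hy : f^[m'] y = y + n * v') : f^[m'] x = x + n * v' := by
  have h := displacement_eq_of_degree_one hmono hf hn hx hy
  have hmm := iterate_mul_of_degree_one hf hx m'
  rw [h, Nat.mul_comm] at hmm
  have hF := hmono.iterate m'
  rcases lt_trichotomy (f^[m'] x) (x + n * v') with hlt | heq | hgt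
  · exfalso
    have key : ∀ K : ℕ, 0 < K → f^[m' * K] x < x + n * (v' * K) := by
      intro K hK
      induction K, hK using Nat.le_induction with
      | base => simpa using hlt
      | succ K hK ih =>
        have h1 := (hmono.iterate (m' * K)) hlt.le
        rw [iterate_add_mul_of_degree_one hf, ← Function.iterate_add_apply] at h1
        rw [Nat.mul_succ]
        push_cast
        linarith
    exact absurd hmm (key m hm).ne
  · exact heq
  · exfalso
    have key : ∀ K : ℕ, 0 < K → x + n * (v' * K) < f^[m' * K] x := by
      intro K hK
      induction K, hK using Nat.le_induction with
      | base => simpa using hgt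
      | succ K hK ih =>
        have h1 := (hmono.iterate (m' * K)) hgt.le
        rw [iterate_add_mul_of_degree_one hf, ← Function.iterate_add_apply] at h1
        rw [Nat.mul_succ]
        push_cast
        linarith
    exact absurd hmm (key m hm).ne'

end DegreeOne

/-! ### The resolution quiver and the lift of `γ` to the integers -/

namespace NakayamaPresentation

section

open Function

variable {k : Type u} [Field k] {n : ℕ} [NeZero n] {A : Type v} [Ring A] [Algebra k A]
  (N : NakayamaPresentation k n A)

theorem gamma_eq (a : ZMod n) : N.gamma a = a + N.projDim a := by
  have : ∀ m : ℕ, tau^[m] a = a + m := by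
    intro m
    induction m with
    | zero => simp
    | succ m ih => rw [iterate_succ_apply', ih, tau]; push_cast; ring
  exact this _

/-- The lift of the Gustafson function to the integers. -/
noncomputable def gammaLift (x : ℤ) : ℤ := x + N.projDim (x : ZMod n)

theorem cast_gammaLift (x : ℤ) : ((N.gammaLift x : ℤ) : ZMod n) = N.gamma x := by
  rw [gammaLift, gamma_eq]; push_cast; rfl

theorem cast_iterate_gammaLift (m : ℕ) (x : ℤ) :
    ((N.gammaLift^[m] x : ℤ) : ZMod n) = N.gamma^[m] x := by
  induction m generalizing x with
  | zero => rfl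
  | succ m ih => rw [iterate_succ_apply, ih, cast_gammaLift, iterate_succ_apply]

theorem gammaLift_add (x : ℤ) : N.gammaLift (x + n) = N.gammaLift x + n := by
  simp only [gammaLift, Int.cast_add, Int.cast_natCast, CharP.cast_eq_zero, add_zero]
  ring

theorem iterate_gammaLift (m : ℕ) (x : ℤ) :
    N.gammaLift^[m] x = x + ∑ i ∈ Finset.range m, (N.projDim (N.gamma^[i] (x : ZMod n)) : ℤ) := by
  induction m with
  | zero => simp
  | succ m ih =>
    rw [iterate_succ_apply', gammaLift, cast_iterate_gammaLift, ih, Finset.sum_range_succ,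
      add_assoc]

theorem natCast_pos : (0 : ℤ) < n := by exact_mod_cast NeZero.pos n

variable {N} in
theorem IsCyclic.iterate {a : ZMod n} (ha : N.IsCyclic a) (m : ℕ) : N.IsCyclic (N.gamma^[m] a) :=
  ((bijOn_periodicPts N.gamma).mapsTo.iterate m) ha

theorem exists_forall_isCyclic_iterate : ∃ m, ∀ a, N.IsCyclic (N.gamma^[m] a) := by
  have h : ∀ a, ∃ m, N.IsCyclic (N.gamma^[m] a) := by
    intro a
    obtain ⟨i, j, hij, h⟩ : ∃ i j, i < j ∧ N.gamma^[i] a = N.gamma^[j] a := by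
      obtain ⟨i, j, hne, h⟩ := Finite.exists_ne_map_eq_of_infinite (fun m : ℕ => N.gamma^[m] a)
      rcases lt_or_gt_of_ne hne with h' | h'
      · exact ⟨i, j, h', h⟩
      · exact ⟨j, i, h', h.symm⟩
    refine ⟨i, mk_mem_periodicPts (n := j - i) (by omega) ?_⟩
    rw [IsPeriodicPt, IsFixedPt, ← iterate_add_apply, Nat.sub_add_cancel hij.le, h]
  choose m hm using h
  refine ⟨∑ a, m a, fun a => ?_⟩
  rw [← Finset.sum_erase_add _ _ (Finset.mem_univ a), iterate_add_apply]
  exact (hm a).iterate _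

variable {N} in
theorem IsCyclic.exists_preimage {a : ZMod n} (ha : N.IsCyclic a) (m : ℕ) :
    ∃ b, N.IsCyclic b ∧ N.gamma^[m] b = a :=
  ((bijOn_periodicPts N.gamma).iterate m).surjOn ha

theorem exists_iterate_eq_of_sameComponent {a b : ZMod n} (h : N.SameComponent a b) :
    ∃ i j, N.gamma^[i] a = N.gamma^[j] b := by
  induction h with
  | rel x y h => exact ⟨1, 0, h⟩
  | refl x => exact ⟨0, 0, rfl⟩
  | symm x y _ ih => obtain ⟨i, j, h⟩ := ih; exact ⟨j, i, h.symm⟩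
  | trans x y z _ _ ih1 ih2 =>
    obtain ⟨i, j, h1⟩ := ih1
    obtain ⟨i', j', h2⟩ := ih2
    refine ⟨i' + i, j + j', ?_⟩
    rw [iterate_add_apply, h1, ← iterate_add_apply, Nat.add_comm, iterate_add_apply, h2,
      ← iterate_add_apply]

theorem sameComponent_iterate (a : ZMod n) (m : ℕ) : N.SameComponent a (N.gamma^[m] a) := by
  induction m with
  | zero => exact Relation.EqvGen.refl _
  | succ m ih =>
    rw [iterate_succ_apply']
    exact ih.trans _ _ _ (Relation.EqvGen.rel _ _ rfl)

variable {N} in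
theorem IsCyclic.exists_iterate_eq {a b : ZMod n} (hb : N.IsCyclic b)
    (h : N.SameComponent a b) : ∃ i, N.gamma^[i] a = b := by
  obtain ⟨i, j, h⟩ := N.exists_iterate_eq_of_sameComponent h
  obtain ⟨m, hm, hm'⟩ := hb
  -- Another `m * j - j` steps complete `j` rounds of a period of `b`, undoing the `j` steps taken
  -- from `b`.
  refine ⟨(m * j - j) + i, ?_⟩
  rw [iterate_add_apply, h, ← iterate_add_apply, Nat.sub_add_cancel (Nat.le_mul_of_pos_left _ hm)]
  exact hm'.mul_const j

theorem exists_sum_eq_mul {a : ZMod n} {m : ℕ} (h : N.gamma^[m] a = a) :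
    ∃ w : ℕ, ∑ i ∈ Finset.range m, N.projDim (N.gamma^[i] a) = n * w := by
  obtain ⟨x, rfl⟩ := ZMod.intCast_surjective a
  have h1 := N.iterate_gammaLift m x
  have h2 := congrArg (Int.cast : ℤ → ZMod n) h1
  rw [cast_iterate_gammaLift, h] at h2
  push_cast at h2
  have h3 : ((∑ i ∈ Finset.range m, N.projDim (N.gamma^[i] (x : ZMod n)) : ℕ) : ZMod n) = 0 := by
    push_cast; simpa using h2.symm
  exact (ZMod.natCast_eq_zero_iff _ _).1 h3

/-- The weight of a cyclic vertex is a natural number. -/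
theorem exists_weight_eq (a : ZMod n) : ∃ w : ℕ, N.weight a = w ∧
    ∀ x : ℤ, (x : ZMod n) = a →
      N.gammaLift^[minimalPeriod N.gamma a] x = x + n * w := by
  obtain ⟨w, hw⟩ := N.exists_sum_eq_mul (iterate_minimalPeriod (f := N.gamma) (x := a))
  refine ⟨w, ?_, ?_⟩
  · have : (n : ℚ) ≠ 0 := by exact_mod_cast NeZero.ne n
    rw [weight, ← Nat.cast_sum, hw]
    push_cast
    field_simp
  · rintro x rfl
    rw [iterate_gammaLift]
    exact_mod_cast congrArg (fun t : ℤ => x + t) (congrArg (Nat.cast : ℕ → ℤ) hw)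

theorem exists_isCyclic : ∃ a, N.IsCyclic a := by
  obtain ⟨m, hm⟩ := N.exists_forall_isCyclic_iterate
  exact ⟨_, hm 0⟩

/-- Since `γ` permutes the cyclic vertices, a preimage exists modulo `n`; a translation by a
multiple of `n` makes it exact. -/
theorem exists_isCyclic_iterate_gammaLift_eq {a : ℤ} (ha : N.IsCyclic a) (m : ℕ) :
    ∃ x : ℤ, N.IsCyclic x ∧ N.gammaLift^[m] x = a := by
  obtain ⟨b, hb, h⟩ := ha.exists_preimage m
  obtain ⟨x, rfl⟩ := ZMod.intCast_surjective b
  rw [← cast_iterate_gammaLift, ZMod.intCast_eq_intCast_iff_dvd_sub] at h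
  obtain ⟨t, ht⟩ := h
  refine ⟨x + n * t, by simpa using hb, ?_⟩
  rw [iterate_add_mul_of_degree_one N.gammaLift_add]
  linarith

variable [FiniteDimensional k A]

theorem lt_gammaLift (x : ℤ) : x < N.gammaLift x := by
  have := N.projDim_pos (x : ZMod n)
  rw [gammaLift]; omega

theorem monotone_gammaLift : Monotone N.gammaLift := by
  refine monotone_int_of_le_succ fun x => ?_
  have := N.projDim_le_projDim_add_one (x : ZMod n)
  rw [gammaLift, gammaLift]
  push_cast
  omega

theorem strictMono_iterate_gammaLift (x : ℤ) : StrictMono fun i => N.gammaLift^[i] x := by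
  refine strictMono_nat_of_lt_succ fun i => ?_
  rw [iterate_succ_apply']
  exact N.lt_gammaLift _

theorem minimalPeriod_dvd_of_isCyclic {a c : ZMod n} (ha : N.IsCyclic a) :
    minimalPeriod N.gamma a ∣ minimalPeriod N.gamma c := by
  obtain ⟨w, -, hw⟩ := N.exists_weight_eq a
  obtain ⟨w', -, hw'⟩ := N.exists_weight_eq c
  obtain ⟨x, rfl⟩ := ZMod.intCast_surjective a
  obtain ⟨y, rfl⟩ := ZMod.intCast_surjective c
  have h := iterate_eq_of_degree_one N.monotone_gammaLift N.gammaLift_add natCast_pos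
    (minimalPeriod_pos_of_mem_periodicPts ha) (hw x rfl) (hw' y rfl)
  rw [← isPeriodicPt_iff_minimalPeriod_dvd, IsPeriodicPt, IsFixedPt, ← cast_iterate_gammaLift, h]
  simp

/-- All cycles of the resolution quiver have the same weight. -/
theorem weight_eq_of_isCyclic {a c : ZMod n} (ha : N.IsCyclic a) (hc : N.IsCyclic c) :
    N.weight a = N.weight c := by
  obtain ⟨w, hwa, hw⟩ := N.exists_weight_eq a
  obtain ⟨w', hwc, hw'⟩ := N.exists_weight_eq c
  rw [hwa, hwc]
  have hper := Nat.dvd_antisymm (N.minimalPeriod_dvd_of_isCyclic (c := c) ha)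
    (N.minimalPeriod_dvd_of_isCyclic (c := a) hc)
  have hpos := minimalPeriod_pos_of_mem_periodicPts ha
  obtain ⟨x, rfl⟩ := ZMod.intCast_surjective a
  obtain ⟨y, rfl⟩ := ZMod.intCast_surjective c
  have h := displacement_eq_of_degree_one N.monotone_gammaLift N.gammaLift_add natCast_pos
    (hw x rfl) (hw' y rfl)
  rw [← hper] at h
  have := mul_right_cancel₀ (by exact_mod_cast hpos.ne') h
  exact_mod_cast this

/-- The adjoint sends `y` to the least `z` with `y ≤ z + p_z`, the starting point of the injective
envelope of an interval ending at `y`. The search is bounded below because each `p_z` is at most the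
sum of all `p_a`. -/
theorem exists_gc_gammaLift : ∃ g : ℤ → ℤ, GaloisConnection g N.gammaLift := by
  have h : ∀ y : ℤ, ∃ z, y ≤ N.gammaLift z ∧ ∀ x, y ≤ N.gammaLift x → z ≤ x := by
    intro y
    refine Int.exists_least_of_bdd ⟨y - ∑ a, (N.projDim a : ℤ), fun z hz => ?_⟩
      ⟨y, (N.lt_gammaLift y).le⟩
    have := Finset.single_le_sum (f := fun a => (N.projDim a : ℤ)) (fun a _ => by positivity)
      (Finset.mem_univ (z : ZMod n))
    simp only [gammaLift] at hz this
    linarith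
  choose g hg hg' using h
  refine ⟨g, fun y x => ⟨fun hx => (hg y).trans (N.monotone_gammaLift hx), hg' y x⟩⟩

theorem _root_.GaloisConnection.iterate_int {f g : ℤ → ℤ} (h : GaloisConnection g f) (m : ℕ) :
    GaloisConnection g^[m] f^[m] := by
  induction m with
  | zero => exact GaloisConnection.id
  | succ m ih =>
    rw [iterate_succ', iterate_succ]
    exact ih.compose h

/-- No orbit jumps over `a` at step `j` for some `j` if and only if no cyclic orbit does. -/
theorem exists_forall_le_iff {a : ℤ} :
    (∃ j, ∀ x, a + 1 ≤ N.gammaLift^[j + 1] x ↔ a ≤ N.gammaLift^[j] x) ↔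
      ∀ x : ℤ, N.IsCyclic x → x < a → N.gammaLift x ≤ a := by
  constructor
  · rintro ⟨j, hj⟩ x hx hlt
    obtain ⟨z, -, rfl⟩ := N.exists_isCyclic_iterate_gammaLift_eq hx j
    by_contra! h
    rw [← iterate_succ_apply' N.gammaLift] at h
    exact absurd ((hj z).1 h) (not_le.2 hlt)
  · intro h
    -- After this many steps every orbit is cyclic, so the hypothesis applies to all integers at
    -- once.
    obtain ⟨j, hj⟩ := N.exists_forall_isCyclic_iterate
    refine ⟨j, fun x => ⟨fun hx => ?_, fun hx => ?_⟩⟩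
    · by_contra! hlt
      have := h _ (by rw [cast_iterate_gammaLift]; exact hj _) hlt
      rw [← iterate_succ_apply' N.gammaLift] at this
      exact absurd hx (by rw [not_le]; exact Int.lt_add_one_of_le this)
    · rw [iterate_succ_apply']
      have := N.lt_gammaLift (N.gammaLift^[j] x)
      omega

/-- If nothing jumps over `a`, then the largest cyclic integer `b` below `a` maps to `a`, and
monotonicity carries this gap along the orbit of `b`. That orbit then exhausts the cyclic integers
from `b` on. Conversely, weight `1` makes translation by `n` an iterate on cyclic points, so by
connectedness they lie on one orbit. -/
theorem forall_isCyclic_le_iff {a : ℤ} (ha : N.IsCyclic a) :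
    (∀ x : ℤ, N.IsCyclic x → x < a → N.gammaLift x ≤ a) ↔
      N.IsConnected ∧ N.weight a = 1 := by
  have hn : (0 : ℤ) < n := natCast_pos
  constructor
  · intro h
    obtain ⟨b, ⟨hb, hba⟩, hmax⟩ : ∃ b : ℤ, (N.IsCyclic b ∧ b < a) ∧
        ∀ z : ℤ, (N.IsCyclic z ∧ z < a) → z ≤ b :=
      Int.exists_greatest_of_bdd ⟨a, fun z hz => hz.2.le⟩ ⟨a - n, by simpa using ha, by omega⟩
    have hcyc : ∀ i, N.IsCyclic ((N.gammaLift^[i] b : ℤ) : ZMod n) := fun i => by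
      rw [cast_iterate_gammaLift]; exact hb.iterate i
    have hfb : N.gammaLift b = a := by
      by_contra hne
      have h1 := hmax (N.gammaLift b) ⟨hcyc 1, lt_of_le_of_ne (h b hb hba) hne⟩
      exact absurd (N.lt_gammaLift b) (not_lt.2 h1)
    have hgap : ∀ i, ∀ z : ℤ, N.IsCyclic z → N.gammaLift^[i] b < z →
        N.gammaLift^[i + 1] b ≤ z := by
      intro i
      induction i with
      | zero =>
        intro z hz hlt
        by_contra! h'
        simp only [zero_add, iterate_one, hfb] at h'
        exact absurd (hmax z ⟨hz, h'⟩) (not_le.2 hlt)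
      | succ i ih =>
        intro z hz hlt
        obtain ⟨z', hz', rfl⟩ := N.exists_isCyclic_iterate_gammaLift_eq hz 1
        rw [iterate_one] at hlt ⊢
        rw [iterate_succ_apply']
        refine N.monotone_gammaLift (ih z' hz' ?_)
        by_contra! h'
        rw [iterate_succ_apply'] at hlt
        exact absurd (N.monotone_gammaLift h') (not_le.2 hlt)
    have horb : ∀ z : ℤ, N.IsCyclic z → b ≤ z → ∃ i, N.gammaLift^[i] b = z := by
      intro z hz hbz
      by_contra! hne
      have : ∀ i : ℕ, N.gammaLift^[i] b < z := by
        intro i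
        induction i with
        | zero => exact lt_of_le_of_ne hbz (hne 0)
        | succ i ih => exact lt_of_le_of_ne (hgap i z hz ih) (hne _)
      have h1 : ∀ i : ℕ, b + i ≤ N.gammaLift^[i] b := by
        intro i
        induction i with
        | zero => simp
        | succ i ih =>
          have : N.gammaLift^[i] b < N.gammaLift^[i + 1] b :=
            N.strictMono_iterate_gammaLift b (Nat.lt_succ_self i)
          push_cast
          omega
      have h2 := h1 (z - b).toNat
      have h3 := this (z - b).toNat
      rw [Int.toNat_of_nonneg (by omega)] at h2
      omega
    refine ⟨?_, ?_⟩
    · have hall : ∀ c, N.SameComponent b c := by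
        intro c
        obtain ⟨j, hj⟩ := N.exists_forall_isCyclic_iterate
        have h1 := hj c
        obtain ⟨z, hz⟩ := ZMod.intCast_surjective (N.gamma^[j] c)
        let z' := z + n * |b - z|
        have hz' : (z' : ZMod n) = N.gamma^[j] c := by simp [z', hz]
        obtain ⟨i, hi⟩ := horb z' (by rw [hz']; exact h1)
          (by simp only [z']; nlinarith [le_abs_self (b - z), abs_nonneg (b - z)])
        refine (N.sameComponent_iterate b i).trans _ _ _ ?_
        rw [← cast_iterate_gammaLift, hi, hz']
        exact (N.sameComponent_iterate c j).symm _ _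
      exact fun c d => ((hall c).symm _ _).trans _ _ _ (hall d)
    · rw [N.weight_eq_of_isCyclic ha hb]
      obtain ⟨w, hw, hw'⟩ := N.exists_weight_eq (b : ZMod n)
      -- The orbit reaches `b + n`, so the displacement `n` is a multiple of the displacement `n *
      -- w` of one period.
      obtain ⟨i, hi⟩ := horb (b + n) (by simpa using hb) (by omega)
      have hper : minimalPeriod N.gamma (b : ZMod n) ∣ i := by
        rw [← isPeriodicPt_iff_minimalPeriod_dvd, IsPeriodicPt, IsFixedPt,
          ← cast_iterate_gammaLift, hi]
        simp
      obtain ⟨q, rfl⟩ := hper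
      rw [iterate_mul_of_degree_one N.gammaLift_add (hw' b rfl)] at hi
      have h1 : (w : ℤ) * q = 1 := by
        have := add_left_cancel hi
        exact mul_left_cancel₀ hn.ne' (by rw [this, mul_one])
      have h2 : w * q = 1 := by exact_mod_cast h1
      rw [hw, Nat.eq_one_of_mul_eq_one_right h2, Nat.cast_one]
  · rintro ⟨hconn, hwt⟩ x hx hxa
    rw [N.weight_eq_of_isCyclic ha hx] at hwt
    obtain ⟨w, hw, hw'⟩ := N.exists_weight_eq (x : ZMod n)
    have hw1 : w = 1 := by rw [hw] at hwt; exact_mod_cast hwt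
    subst hw1
    set m := minimalPeriod N.gamma (x : ZMod n) with hm
    have hmx : N.gammaLift^[m] x = x + n * (1 : ℤ) := by simpa using hw' x rfl
    obtain ⟨j, hj⟩ := ha.exists_iterate_eq (hconn x a)
    rw [← cast_iterate_gammaLift, ZMod.intCast_eq_intCast_iff_dvd_sub] at hj
    obtain ⟨t, ht⟩ := hj
    -- The orbit of `x` meets `a` modulo `n`, and the difference is corrected by full periods. If
    -- that needed more steps back than were taken, `x` would lie on the orbit of `a`, against `x <
    -- a`.
    have hup : ∃ i, N.gammaLift^[i] x = a := by
      obtain ⟨s, rfl | rfl⟩ := Int.eq_nat_or_neg t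
      · refine ⟨j + m * s, ?_⟩
        rw [iterate_add_apply, iterate_mul_of_degree_one N.gammaLift_add hmx,
          iterate_add_mul_of_degree_one N.gammaLift_add]
        linarith
      · rcases le_total (m * s) j with h | h
        · refine ⟨j - m * s, ?_⟩
          have h1 : N.gammaLift^[j] x = N.gammaLift^[j - m * s] x + n * (1 * s) := by
            rw [← iterate_add_mul_of_degree_one N.gammaLift_add,
              ← iterate_mul_of_degree_one N.gammaLift_add hmx, ← iterate_add_apply]
            congr 1; omega
          linarith
        · exfalso
          have h1 : N.gammaLift^[m * s - j] a = x := by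
            have : a = N.gammaLift^[j] x + n * (-s : ℤ) := by linarith
            rw [this, iterate_add_mul_of_degree_one N.gammaLift_add, ← iterate_add_apply,
              Nat.sub_add_cancel h, iterate_mul_of_degree_one N.gammaLift_add hmx]
            ring
          have h2 := (N.strictMono_iterate_gammaLift a).monotone (Nat.zero_le (m * s - j))
          simp only [iterate_zero, id] at h2
          omega
    obtain ⟨i, rfl⟩ := hup
    rcases Nat.eq_zero_or_pos i with rfl | hi
    · simp at hxa
    · exact (N.strictMono_iterate_gammaLift x).monotone hi

/-! ### Injective dimension of the simple modules -/

open CategoryTheory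

theorem path_ne_zero_of_le_gammaLift {x y : ℤ} (h : y ≤ N.gammaLift x) {l : ℕ}
    (hl : x + l < y) : N.path (x : ZMod n) l ≠ 0 := by
  rw [path_ne_zero_iff_lt_projDim]
  rw [gammaLift] at h
  omega

theorem hasInjectiveDimensionLT_zero_uniserial_iff {x y : ℤ} (h : x ≤ y)
    (h' : y ≤ N.gammaLift x) :
    HasInjectiveDimensionLT (ModuleCat.of Aᵐᵒᵖ (N.uniserial (x : ZMod n) (y - x).toNat)) 0 ↔
      x = y := by
  rw [hasInjectiveDimensionLT_zero_iff_isZero, ModuleCat.isZero_of_iff_subsingleton,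
    N.subsingleton_uniserial_iff
      (fun l hl => N.path_ne_zero_of_le_gammaLift h' (show x + l < y by omega))]
  omega

/-- The cosyzygies of the uniserial module with composition factors `S_x`, …, `S_{y-1}`. -/
theorem hasInjectiveDimensionLT_uniserial_iff {g : ℤ → ℤ} (hg : GaloisConnection g N.gammaLift)
    (d : ℕ) (s : ℕ → ℤ) (hs : ∀ i, s (i + 2) = g (s i)) (h10 : s 1 ≤ s 0)
    (h01 : s 0 ≤ N.gammaLift (s 1)) :
    HasInjectiveDimensionLT (ModuleCat.of Aᵐᵒᵖ (N.uniserial (s 1 : ZMod n) (s 0 - s 1).toNat)) d ↔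
      ∃ i ≤ d, s (i + 1) = s i := by
  have hz := N.hasInjectiveDimensionLT_zero_uniserial_iff h10 h01
  induction d generalizing s with
  | zero => rw [hz]; simp
  | succ d ih =>
    by_cases heq : s 1 = s 0
    · refine ⟨fun _ => ⟨0, by omega, heq⟩, fun _ => ?_⟩
      have := hz.2 heq
      exact hasInjectiveDimensionLT_of_ge _ 0 _ (by omega)
    · have hle : s 2 ≤ s 1 := by rw [hs 0]; exact (hg _ _).2 h01
      have hle2 : s 0 ≤ N.gammaLift (s 2) := by rw [hs 0]; exact (hg _ _).1 le_rfl
      -- By minimality of `g (s 0)` the interval cannot be extended to the left, which is the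
      -- vanishing condition for injectivity of `[s 2, s 0)`.
      have hlt : N.gammaLift (s 2 - 1) < s 0 := by
        by_contra! h
        have h2 := (hg _ _).2 h
        have h3 : s 2 = g (s 0) := hs 0
        omega
      have hs1 : (s 1 : ZMod n) = (s 2 : ZMod n) + ((s 1 - s 2).toNat : ZMod n) := by
        rw [← Int.cast_natCast (R := ZMod n), Int.toNat_of_nonneg (by omega)]
        push_cast; ring
      have ih' : HasInjectiveDimensionLT
          (ModuleCat.of Aᵐᵒᵖ (N.uniserial (s 2 : ZMod n) (s 1 - s 2).toNat)) d ↔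
            ∃ i ≤ d, s (i + 2) = s (i + 1) :=
              ih (fun i => s (i + 1)) (fun i => hs (i + 1)) hle (h10.trans hle2)
        (N.hasInjectiveDimensionLT_zero_uniserial_iff hle (h10.trans hle2))
      rw [hs1, N.hasInjectiveDimensionLT_uniserial_succ
        (fun l hl => N.path_ne_zero_of_le_gammaLift hle2 (by omega)) (by omega) ?_, ih']
      · constructor
        · rintro ⟨i, hi, h⟩
          exact ⟨i + 1, by omega, h⟩
        · rintro ⟨_ | i, hi, h⟩
          · exact absurd h heq
          · exact ⟨i, by omega, h⟩
      · rw [path_eq_zero_iff_projDim_le]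
        rw [gammaLift] at hlt
        push_cast at hlt
        omega

theorem simpleInjDim_lt_iff {g : ℤ → ℤ} (hg : GaloisConnection g N.gammaLift) (a : ℤ) (d : ℕ) :
    N.simpleInjDim (a : ZMod n) < d ↔
      ∃ i ≤ d, g^[(i + 1) / 2] (if (i + 1) % 2 = 0 then a + 1 else a) =
        g^[i / 2] (if i % 2 = 0 then a + 1 else a) := by
  rw [simpleInjDim_eq, injectiveDimension_lt_iff]
  have h := N.hasInjectiveDimensionLT_uniserial_iff hg d
    (fun i => g^[i / 2] (if i % 2 = 0 then a + 1 else a)) (fun i => ?_) (by simp)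
    (by simpa using N.lt_gammaLift a)
  · rw [← h]
    have h1 : ∀ L, L = 1 →
        (HasInjectiveDimensionLT (ModuleCat.of Aᵐᵒᵖ (N.uniserial (a : ZMod n) 1)) d ↔
          HasInjectiveDimensionLT (ModuleCat.of Aᵐᵒᵖ (N.uniserial (a : ZMod n) L)) d) := by
      rintro _ rfl; rfl
    exact h1 (a + 1 - a).toNat (by omega)
  · have h1 : (i + 2) / 2 = i / 2 + 1 := by omega
    have h2 : (i + 2) % 2 = i % 2 := by omega
    simp only [h1, h2, iterate_succ_apply']

/-- The simple module at a cyclic vertex `a` has finite even injective dimension if and only if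
the orbits of the cyclic vertices do not jump over `a`. -/
theorem exists_simpleInjDim_eq_iff {a : ℤ} (ha : N.IsCyclic a) :
    (∃ m : ℕ, N.simpleInjDim (a : ZMod n) = ((2 * m : ℕ) : WithBot ℕ∞)) ↔
      ∃ j, ∀ x, a + 1 ≤ N.gammaLift^[j + 1] x ↔ a ≤ N.gammaLift^[j] x := by
  classical
  obtain ⟨g, hg⟩ := N.exists_gc_gammaLift
  -- By adjunction both sides say that two integers have the same upper bounds.
  have hodd : ∀ j, (∀ x, a + 1 ≤ N.gammaLift^[j + 1] x ↔ a ≤ N.gammaLift^[j] x) ↔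
      g^[j + 1] (a + 1) = g^[j] a := by
    intro j
    simp only [← (hg.iterate_int _ _ _)]
    exact ⟨eq_of_forall_ge_iff, fun h x => by rw [h]⟩
  -- Cyclicity enters here: writing `a` as the `j`-th iterate of some `x` gives `g^[j] a ≤ x < g^[j]
  -- (a + 1)`. Only coincidences at odd places remain.
  have heven : ∀ j, g^[j] a ≠ g^[j] (a + 1) := by
    intro j h
    obtain ⟨x, -, hx⟩ := N.exists_isCyclic_iterate_gammaLift_eq ha j
    have h1 := (hg.iterate_int j _ _).2 hx.ge
    rw [h] at h1
    have h2 := (hg.iterate_int j _ _).1 h1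
    omega
  simp only [hodd]
  have hlt : ∀ d : ℕ, N.simpleInjDim (a : ZMod n) < d ↔
      ∃ j, 2 * j + 1 ≤ d ∧ g^[j + 1] (a + 1) = g^[j] a := by
    intro d
    rw [N.simpleInjDim_lt_iff hg]
    constructor
    · rintro ⟨i, hi, h⟩
      obtain ⟨j, rfl | rfl⟩ := Nat.even_or_odd' i
      · exfalso
        have h1 : (2 * j + 1) / 2 = j := by omega
        have h2 : (2 * j + 1) % 2 = 1 := by omega
        have h3 : (2 * j) / 2 = j := by omega
        have h4 : (2 * j) % 2 = 0 := by omega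
        rw [h1, h2, h3, h4] at h
        exact heven j (by simpa using h)
      · refine ⟨j, hi, ?_⟩
        have h1 : (2 * j + 1) / 2 = j := by omega
        have h2 : (2 * j + 1) % 2 = 1 := by omega
        have h3 : (2 * j + 1 + 1) / 2 = j + 1 := by omega
        have h4 : (2 * j + 1 + 1) % 2 = 0 := by omega
        rw [h1, h2, h3, h4] at h
        simpa using h
    · rintro ⟨j, hj, h⟩
      refine ⟨2 * j + 1, hj, ?_⟩
      have h1 : (2 * j + 1) / 2 = j := by omega
      have h2 : (2 * j + 1) % 2 = 1 := by omega
      have h3 : (2 * j + 1 + 1) / 2 = j + 1 := by omega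
      have h4 : (2 * j + 1 + 1) % 2 = 0 := by omega
      rw [h1, h2, h3, h4]
      simpa using h
  constructor
  · rintro ⟨m, hm⟩
    have : N.simpleInjDim (a : ZMod n) < ((2 * m + 1 : ℕ) : WithBot ℕ∞) := by
      rw [hm]
      exact_mod_cast Nat.lt_succ_self (2 * m)
    obtain ⟨j, -, h⟩ := (hlt _).1 this
    exact ⟨j, h⟩
  · intro hex
    -- The first coincidence, at place `2 * j + 1`, gives dimension exactly `2 * j`.
    refine ⟨Nat.find hex, le_antisymm ?_ ?_⟩
    · have := (hlt (2 * Nat.find hex + 1)).2 ⟨_, le_rfl, Nat.find_spec hex⟩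
      rw [simpleInjDim, injectiveDimension_lt_iff] at this
      rw [simpleInjDim, injectiveDimension_le_iff]
      exact this
    · by_contra! h
      obtain ⟨j, hj, hj'⟩ := (hlt _).1 h
      exact Nat.find_min hex (by omega) hj'

/-- Madsen's and Shen's criteria for finite global dimension are equivalent. -/
theorem exists_isCyclic_simpleInjDim_eq_iff :
    (∃ a : ZMod n, N.IsCyclic a ∧ ∃ m : ℕ, N.simpleInjDim a = ((2 * m : ℕ) : WithBot ℕ∞)) ↔
      N.IsConnected ∧ ∀ c : ZMod n, N.IsCyclic c → N.weight c = 1 := by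
  have key : ∀ a : ZMod n, N.IsCyclic a →
      ((∃ m : ℕ, N.simpleInjDim a = ((2 * m : ℕ) : WithBot ℕ∞)) ↔
        N.IsConnected ∧ N.weight a = 1) := by
    intro a ha
    obtain ⟨a, rfl⟩ := ZMod.intCast_surjective a
    rw [N.exists_simpleInjDim_eq_iff ha, N.exists_forall_le_iff, N.forall_isCyclic_le_iff ha]
  constructor
  · rintro ⟨a, ha, h⟩
    obtain ⟨h1, h2⟩ := (key a ha).1 h
    exact ⟨h1, fun c hc => by rw [N.weight_eq_of_isCyclic hc ha, h2]⟩
  · rintro ⟨h1, h2⟩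
    obtain ⟨a, ha⟩ := N.exists_isCyclic
    exact ⟨a, ha, (key a ha).2 ⟨h1, h2 a ha⟩⟩

end

end NakayamaPresentation

/-! ### Values of rational functions at `t = 1` -/

section ValueAtOne

open Polynomial

namespace RatFunc

theorem HasValueAtOne.unique {f : RatFunc ℚ} {c d : ℚ} (hc : f.HasValueAtOne c)
    (hd : f.HasValueAtOne d) : c = d := hc.2.symm.trans hd.2

theorem HasValueAtOne.add {f g : RatFunc ℚ} {c d : ℚ} (hf : f.HasValueAtOne c)
    (hg : g.HasValueAtOne d) : (f + g).HasValueAtOne (c + d) := by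
  refine ⟨fun h => ?_, ?_⟩
  · have := eval_eq_zero_of_dvd_of_eval_eq_zero (denom_add_dvd f g) h
    rw [Polynomial.eval_mul] at this
    exact mul_ne_zero hf.1 hg.1 this
  · rw [RatFunc.eval_add (f := RingHom.id ℚ) (a := 1) hf.1 hg.1, hf.2, hg.2]

theorem HasValueAtOne.mul {f g : RatFunc ℚ} {c d : ℚ} (hf : f.HasValueAtOne c)
    (hg : g.HasValueAtOne d) : (f * g).HasValueAtOne (c * d) := by
  refine ⟨fun h => ?_, ?_⟩
  · have := eval_eq_zero_of_dvd_of_eval_eq_zero (denom_mul_dvd f g) h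
    rw [Polynomial.eval_mul] at this
    exact mul_ne_zero hf.1 hg.1 this
  · rw [RatFunc.eval_mul (f := RingHom.id ℚ) (a := 1) hf.1 hg.1, hf.2, hg.2]

theorem hasValueAtOne_algebraMap (p : ℚ[X]) :
    (algebraMap ℚ[X] (RatFunc ℚ) p).HasValueAtOne (p.eval 1) := by
  refine ⟨by simp, by simp [RatFunc.eval_algebraMap]⟩

theorem hasValueAtOne_zero : (0 : RatFunc ℚ).HasValueAtOne 0 := by
  simpa using hasValueAtOne_algebraMap 0

theorem hasValueAtOne_one : (1 : RatFunc ℚ).HasValueAtOne 1 := by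
  simpa using hasValueAtOne_algebraMap 1

theorem hasValueAtOne_natCast (m : ℕ) : (m : RatFunc ℚ).HasValueAtOne m := by
  simpa using hasValueAtOne_algebraMap (m : ℚ[X])

theorem hasValueAtOne_X_pow (m : ℕ) : ((RatFunc.X : RatFunc ℚ) ^ m).HasValueAtOne 1 := by
  simpa using hasValueAtOne_algebraMap ((Polynomial.X : ℚ[X]) ^ m)

theorem hasValueAtOne_one_sub_X : (1 - RatFunc.X : RatFunc ℚ).HasValueAtOne 0 := by
  have h := hasValueAtOne_algebraMap (1 - Polynomial.X : ℚ[X])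
  rwa [map_sub, map_one, RatFunc.algebraMap_X, Polynomial.eval_sub, Polynomial.eval_one,
    Polynomial.eval_X, sub_self] at h

theorem HasValueAtOne.sum {ι : Type*} {s : Finset ι} {f : ι → RatFunc ℚ} {c : ι → ℚ}
    (h : ∀ i ∈ s, (f i).HasValueAtOne (c i)) :
    (∑ i ∈ s, f i).HasValueAtOne (∑ i ∈ s, c i) := by
  classical
  induction s using Finset.induction_on with
  | empty => simpa using hasValueAtOne_zero
  | insert i s hi ih =>
    rw [Finset.sum_insert hi, Finset.sum_insert hi]
    exact (h i (Finset.mem_insert_self _ _)).add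
      (ih fun j hj => h j (Finset.mem_insert_of_mem hj))

theorem hasValueAtOne_geom_sum (m : ℕ) :
    (∑ i ∈ Finset.range m, (RatFunc.X : RatFunc ℚ) ^ i).HasValueAtOne m := by
  simpa using HasValueAtOne.sum (s := Finset.range m) fun i _ => hasValueAtOne_X_pow i

theorem hasValueAtOne_inv_algebraMap {p : ℚ[X]} (hp : p.eval 1 ≠ 0) :
    (algebraMap ℚ[X] (RatFunc ℚ) p)⁻¹.HasValueAtOne (p.eval 1)⁻¹ := by
  have hp0 : p ≠ 0 := by rintro rfl; simp at hp
  have hden : ((algebraMap ℚ[X] (RatFunc ℚ) p)⁻¹).denom.eval 1 ≠ 0 := by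
    intro h
    have h1 := denom_div_dvd (1 : ℚ[X]) p
    rw [map_one, one_div] at h1
    exact hp (eval_eq_zero_of_dvd_of_eval_eq_zero h1 h)
  refine ⟨hden, ?_⟩
  have hmul : (algebraMap ℚ[X] (RatFunc ℚ) p * (algebraMap ℚ[X] (RatFunc ℚ) p)⁻¹).HasValueAtOne
      (p.eval 1 * RatFunc.eval (RingHom.id ℚ) 1 (algebraMap ℚ[X] (RatFunc ℚ) p)⁻¹) :=
    (hasValueAtOne_algebraMap p).mul ⟨hden, rfl⟩
  rw [mul_inv_cancel₀ (by simpa using hp0)] at hmul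
  exact eq_inv_of_mul_eq_one_right (hmul.unique hasValueAtOne_one)

theorem one_sub_X_ne_zero : (1 - RatFunc.X : RatFunc ℚ) ≠ 0 := by
  intro h
  have h1 : algebraMap ℚ[X] (RatFunc ℚ) (1 - Polynomial.X) = 0 := by
    simpa [RatFunc.algebraMap_X] using h
  rw [map_eq_zero_iff _ (RatFunc.algebraMap_injective ℚ)] at h1
  simpa using congrArg (Polynomial.eval 0) h1

theorem geom_sum_mul_one_sub_X (m : ℕ) :
    (∑ i ∈ Finset.range m, (RatFunc.X : RatFunc ℚ) ^ i) * (1 - RatFunc.X) = 1 - RatFunc.X ^ m := by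
  have := geom_sum_mul (RatFunc.X : RatFunc ℚ) m
  linear_combination -this

end RatFunc

end ValueAtOne

/-! ### Weightings on the graded Cartan matrix -/

namespace NakayamaPresentation

section

open Function

variable {k : Type u} [Field k] {n : ℕ} [NeZero n] {A : Type v} [Ring A] [Algebra k A]
  [FiniteDimensional k A] (N : NakayamaPresentation k n A)

/-- At `t = 0` only the trivial paths count, so the matrix becomes the identity. -/
theorem det_gradedCartan_eval_zero : N.gradedCartan.det.eval 0 = 1 := by
  have : (Polynomial.evalRingHom (0 : ℤ)).mapMatrix N.gradedCartan = 1 := by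
    ext a b
    rw [RingHom.mapMatrix_apply, Matrix.map_apply, gradedCartan_apply, map_sum,
      Finset.sum_eq_single 0]
    · by_cases h : b = a
      · subst h; simp
      · simp [h, Matrix.one_apply_ne (Ne.symm h)]
    · intro l _ hl
      split_ifs <;> simp [hl]
    · intro h
      exact absurd (Finset.mem_range.2 (N.projDim_pos b)) h
  rw [← Polynomial.coe_evalRingHom, RingHom.map_det, this, Matrix.det_one]

theorem isUnit_det_gradedCartanRat : IsUnit N.gradedCartanRat.det := by
  let φ : Polynomial ℤ →+* RatFunc ℚ :=
    (algebraMap (Polynomial ℚ) (RatFunc ℚ)).comp (Polynomial.mapRingHom (Int.castRingHom ℚ))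
  have h1 : N.gradedCartanRat = φ.mapMatrix N.gradedCartan := rfl
  have hφ : Injective φ :=
    (RatFunc.algebraMap_injective ℚ).comp
      (Polynomial.map_injective _ (RingHom.injective_int _))
  rw [h1, ← RingHom.map_det, isUnit_iff_ne_zero, Ne, map_eq_zero_iff φ hφ]
  intro h
  have := N.det_gradedCartan_eval_zero
  rw [h] at this
  simp at this

theorem existsUnique_isWeighting : ∃! α : ZMod n → RatFunc ℚ, N.IsWeighting α := by
  have h := N.isUnit_det_gradedCartanRat
  refine ⟨N.gradedCartanRat⁻¹.mulVec fun _ => 1, ?_, ?_⟩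
  · simp only [IsWeighting]
    rw [Matrix.mulVec_mulVec, Matrix.mul_nonsing_inv _ h, Matrix.one_mulVec]
  · intro α hα
    rw [← hα, Matrix.mulVec_mulVec, Matrix.nonsing_inv_mul _ h, Matrix.one_mulVec]

variable {N} {α : ZMod n → RatFunc ℚ}

/-- The recursion of a weighting along the resolution quiver. -/
theorem IsWeighting.eq_add_sum (hα : N.IsWeighting α) (a : ZMod n) :
    α a = 1 - RatFunc.X + ∑ b, if N.gamma b = a then RatFunc.X ^ N.projDim b * α b else 0 := by
  have h1 := congrFun hα a
  have h2 := congrFun hα (a - 1)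
  simp only [Matrix.mulVec, dotProduct, gradedCartanRat_apply] at h1 h2
  -- In row `a` minus `t` times row `a - 1`, column `b` telescopes to its two ends: the trivial path
  -- at `b`, and the vertex `γ(b)` just beyond the last path.
  have key : ∀ b, (∑ l ∈ Finset.range (N.projDim b),
        if b + l = a then (RatFunc.X : RatFunc ℚ) ^ l else 0) -
      RatFunc.X * (∑ l ∈ Finset.range (N.projDim b),
        if b + l = a - 1 then (RatFunc.X : RatFunc ℚ) ^ l else 0) =
      (if b = a then 1 else 0) - (if N.gamma b = a then RatFunc.X ^ N.projDim b else 0) := by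
    intro b
    rw [Finset.mul_sum, ← Finset.sum_sub_distrib, gamma_eq]
    have := Finset.sum_range_sub'
      (fun l : ℕ => if b + l = a then (RatFunc.X : RatFunc ℚ) ^ l else 0) (N.projDim b)
    simp only [Nat.cast_zero, add_zero, pow_zero] at this
    rw [← this]
    refine Finset.sum_congr rfl fun l _ => ?_
    have h3 : b + ((l + 1 : ℕ) : ZMod n) = a ↔ b + (l : ZMod n) = a - 1 := by
      push_cast
      rw [← add_assoc, eq_sub_iff_add_eq]
    by_cases h4 : b + (l : ZMod n) = a - 1
    · rw [if_pos h4, if_pos (h3.2 h4), pow_succ']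
    · rw [if_neg h4, if_neg (fun h => h4 (h3.1 h)), mul_zero]
  have h3 : ∑ b, ((if b = a then 1 else 0) -
      (if N.gamma b = a then RatFunc.X ^ N.projDim b else 0)) * α b = 1 - RatFunc.X := by
    simp only [← key, sub_mul, Finset.sum_sub_distrib, mul_assoc, ← Finset.mul_sum, h1, h2, mul_one]
  simp only [sub_mul, Finset.sum_sub_distrib, ite_mul, one_mul, zero_mul, Finset.sum_ite_eq',
    Finset.mem_univ, if_true] at h3
  linear_combination h3

theorem IsWeighting.div_one_sub_X_hasValueAtOne (hα : N.IsWeighting α) {a : ZMod n}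
    (ha : ¬ N.IsCyclic a) : ∃ c, (α a / (1 - RatFunc.X)).HasValueAtOne c := by
  -- Induction on the height of `a` above the cycles: predecessors of a vertex outside the image of
  -- `γ^(m+1)` lie outside the image of `γ^m`.
  have key : ∀ m a, (∀ b, N.gamma^[m] b ≠ a) →
      ∃ c, (α a / (1 - RatFunc.X)).HasValueAtOne c := by
    intro m
    induction m with
    | zero => exact fun a h => absurd rfl (h a)
    | succ m ih =>
      intro a h
      have h1 : ∀ b, ∃ c, (if N.gamma b = a then
          RatFunc.X ^ N.projDim b * (α b / (1 - RatFunc.X)) else 0).HasValueAtOne c := by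
        intro b
        split_ifs with hb
        · obtain ⟨c, hc⟩ := ih b (fun b' hb' => h b' (by rw [iterate_succ_apply', hb', hb]))
          exact ⟨_, (RatFunc.hasValueAtOne_X_pow _).mul hc⟩
        · exact ⟨_, RatFunc.hasValueAtOne_zero⟩
      choose c hc using h1
      refine ⟨1 + ∑ b, c b, ?_⟩
      rw [hα.eq_add_sum a, add_div, div_self RatFunc.one_sub_X_ne_zero, Finset.sum_div]
      simp only [ite_div, zero_div, mul_div_assoc]
      exact RatFunc.hasValueAtOne_one.add (RatFunc.HasValueAtOne.sum fun b _ => hc b)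
  obtain ⟨m, hm⟩ := N.exists_forall_isCyclic_iterate
  exact key m a fun b hb => ha (hb ▸ hm b)

theorem IsWeighting.hasValueAtOne_of_not_isCyclic (hα : N.IsWeighting α) {a : ZMod n}
    (ha : ¬ N.IsCyclic a) : (α a).HasValueAtOne 0 := by
  obtain ⟨c, hc⟩ := hα.div_one_sub_X_hasValueAtOne ha
  have := RatFunc.hasValueAtOne_one_sub_X.mul hc
  rwa [mul_div_cancel₀ _ RatFunc.one_sub_X_ne_zero, zero_mul] at this

/-- The recursion of a weighting along a cycle of the resolution quiver. -/
theorem IsWeighting.exists_eq_of_isCyclic (hα : N.IsWeighting α) {a : ZMod n}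
    (ha : N.IsCyclic a) : ∃ r : RatFunc ℚ, (∃ c, r.HasValueAtOne c) ∧
      α (N.gamma a) = RatFunc.X ^ N.projDim a * α a + (1 - RatFunc.X) * r := by
  classical
  have h1 : ∀ b, ∃ s : RatFunc ℚ, (∃ c, s.HasValueAtOne c) ∧
      (b ≠ a → (if N.gamma b = N.gamma a then RatFunc.X ^ N.projDim b * α b else 0) =
        (1 - RatFunc.X) * s) := by
    intro b
    by_cases hb : b ≠ a ∧ N.gamma b = N.gamma a
    · have hb' : ¬ N.IsCyclic b := fun hc => hb.1 ((bijOn_periodicPts N.gamma).injOn hc ha hb.2)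
      obtain ⟨c, hc⟩ := hα.div_one_sub_X_hasValueAtOne hb'
      refine ⟨_, ⟨_, (RatFunc.hasValueAtOne_X_pow (N.projDim b)).mul hc⟩, fun _ => ?_⟩
      rw [if_pos hb.2]
      field_simp [RatFunc.one_sub_X_ne_zero]
    · refine ⟨0, ⟨_, RatFunc.hasValueAtOne_zero⟩, fun h => ?_⟩
      rw [if_neg (fun h' => hb ⟨h, h'⟩), mul_zero]
  choose s hs hs' using h1
  choose c hc using hs
  refine ⟨1 + ∑ b ∈ Finset.univ.erase a, s b, ⟨_, RatFunc.hasValueAtOne_one.add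
    (RatFunc.HasValueAtOne.sum fun b _ => hc b)⟩, ?_⟩
  rw [hα.eq_add_sum, ← Finset.add_sum_erase _ _ (Finset.mem_univ a), if_pos rfl,
    Finset.sum_congr rfl fun b hb => hs' b (Finset.ne_of_mem_erase hb), ← Finset.mul_sum]
  ring

theorem IsWeighting.exists_eq_iterate_of_isCyclic (hα : N.IsWeighting α) {a : ZMod n}
    (ha : N.IsCyclic a) (m : ℕ) : ∃ r : RatFunc ℚ, (∃ c, r.HasValueAtOne c) ∧
      α (N.gamma^[m] a) = RatFunc.X ^ (∑ i ∈ Finset.range m, N.projDim (N.gamma^[i] a)) * α a +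
        (1 - RatFunc.X) * r := by
  induction m with
  | zero => exact ⟨0, ⟨_, RatFunc.hasValueAtOne_zero⟩, by simp⟩
  | succ m ih =>
    obtain ⟨r, ⟨c, hc⟩, h⟩ := ih
    obtain ⟨r', ⟨c', hc'⟩, h'⟩ := hα.exists_eq_of_isCyclic (ha.iterate m)
    refine ⟨_, ⟨_, ((RatFunc.hasValueAtOne_X_pow (N.projDim (N.gamma^[m] a))).mul hc).add hc'⟩, ?_⟩
    rw [iterate_succ_apply', h', h, Finset.sum_range_succ]
    ring

/-- Going once round the cycle gives `(1 - t^W) α_a = (1 - t) r` with `r` regular. After cancelling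
`1 - t`, the factor of `α_a` takes the value `W ≠ 0` at `1`. -/
theorem IsWeighting.exists_hasValueAtOne_of_isCyclic (hα : N.IsWeighting α) {a : ZMod n}
    (ha : N.IsCyclic a) : ∃ c, (α a).HasValueAtOne c := by
  obtain ⟨r, ⟨c, hc⟩, h⟩ := hα.exists_eq_iterate_of_isCyclic ha (minimalPeriod N.gamma a)
  rw [iterate_minimalPeriod] at h
  set W := ∑ i ∈ Finset.range (minimalPeriod N.gamma a), N.projDim (N.gamma^[i] a) with hW
  have hW0 : W ≠ 0 :=
    (Finset.sum_pos (fun i _ => N.projDim_pos _)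
      ⟨0, Finset.mem_range.2 (minimalPeriod_pos_of_mem_periodicPts ha)⟩).ne'
  let p : Polynomial ℚ := ∑ i ∈ Finset.range W, Polynomial.X ^ i
  have hp : algebraMap _ (RatFunc ℚ) p = ∑ i ∈ Finset.range W, RatFunc.X ^ i := by
    simp [p, RatFunc.algebraMap_X]
  have hp1 : p.eval 1 ≠ 0 := by simpa [p, Polynomial.eval_finsetSum] using hW0
  have h1 : algebraMap _ (RatFunc ℚ) p * α a = r := by
    apply mul_right_cancel₀ RatFunc.one_sub_X_ne_zero
    rw [mul_right_comm, hp, RatFunc.geom_sum_mul_one_sub_X]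
    linear_combination h
  have h2 : (algebraMap _ (RatFunc ℚ) p)⁻¹ * r = α a := by
    rw [← h1, inv_mul_cancel_left₀]
    simp only [ne_eq, map_eq_zero_iff _ (RatFunc.algebraMap_injective ℚ)]
    intro h0
    rw [h0] at hp1
    simp at hp1
  rw [← h2]
  exact ⟨_, (RatFunc.hasValueAtOne_inv_algebraMap hp1).mul hc⟩

theorem IsWeighting.hasValueAtOne_iterate (hα : N.IsWeighting α) {a : ZMod n}
    (ha : N.IsCyclic a) {c : ℚ} (h : (α a).HasValueAtOne c) (m : ℕ) :
    (α (N.gamma^[m] a)).HasValueAtOne c := by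
  obtain ⟨r, ⟨d, hd⟩, hr⟩ := hα.exists_eq_iterate_of_isCyclic ha m
  rw [hr]
  simpa using ((RatFunc.hasValueAtOne_X_pow _).mul h).add
    (RatFunc.hasValueAtOne_one_sub_X.mul hd)

-- The recursion is summed over a component. Since `γ` preserves components, each `b` in it
-- contributes once, at `γ(b)`; then `1 - t` is cancelled.
open Classical in
theorem IsWeighting.sum_component (hα : N.IsWeighting α) (a : ZMod n) :
    ∑ b with N.SameComponent a b,
      (∑ i ∈ Finset.range (N.projDim b), RatFunc.X ^ i) * α b = (N.componentCard a : RatFunc ℚ) := by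
  have hcard : N.componentCard a = (Finset.univ.filter fun b => N.SameComponent a b).card := by
    rw [componentCard, Nat.card_eq_fintype_card, Fintype.card_subtype]
  apply mul_right_cancel₀ RatFunc.one_sub_X_ne_zero
  have h1 : ∑ x with N.SameComponent a x, α x =
      (N.componentCard a : RatFunc ℚ) * (1 - RatFunc.X) +
        ∑ b with N.SameComponent a b, RatFunc.X ^ N.projDim b * α b := by
    rw [Finset.sum_congr rfl fun x _ => hα.eq_add_sum x, Finset.sum_add_distrib,
      Finset.sum_const, hcard, nsmul_eq_mul, Finset.sum_comm]
    congr 1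
    rw [Finset.sum_filter]
    refine Finset.sum_congr rfl fun b _ => ?_
    have hiff : N.SameComponent a (N.gamma b) ↔ N.SameComponent a b :=
      ⟨fun h => h.trans _ _ _ ((N.sameComponent_iterate b 1).symm _ _),
        fun h => h.trans _ _ _ (N.sameComponent_iterate b 1)⟩
    rw [Finset.sum_ite_eq]
    simp [hiff]
  rw [Finset.sum_mul]
  simp only [mul_right_comm _ _ (1 - RatFunc.X), RatFunc.geom_sum_mul_one_sub_X, sub_mul, one_mul,
    Finset.sum_sub_distrib, h1]
  ring

/-- In the component sum at `t = 1` the noncyclic terms vanish and the cyclic ones share the value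
`c`. The component has only one cycle, so what remains is `n_a = (∑ p_b) c = n w c`. -/
theorem IsWeighting.hasValueAtOne_of_isCyclic (hα : N.IsWeighting α) {a : ZMod n}
    (ha : N.IsCyclic a) :
    (α a).HasValueAtOne ((N.componentCard a : ℚ) / ((n : ℚ) * N.weight a)) := by
  classical
  obtain ⟨c, hc⟩ := hα.exists_hasValueAtOne_of_isCyclic ha
  have hval : ∀ b ∈ Finset.univ.filter fun b => N.SameComponent a b,
      ((∑ i ∈ Finset.range (N.projDim b), RatFunc.X ^ i) * α b).HasValueAtOne
        (N.projDim b * if N.IsCyclic b then c else 0) := by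
    intro b hb
    refine (RatFunc.hasValueAtOne_geom_sum _).mul ?_
    split_ifs with hcyc
    · obtain ⟨i, rfl⟩ := hcyc.exists_iterate_eq (Finset.mem_filter.1 hb).2
      exact hα.hasValueAtOne_iterate ha hc i
    · exact hα.hasValueAtOne_of_not_isCyclic hcyc
  have hsum := RatFunc.HasValueAtOne.sum hval
  rw [hα.sum_component a] at hsum
  have heq := (RatFunc.hasValueAtOne_natCast (N.componentCard a)).unique hsum
  have horbit : ∑ b with N.SameComponent a b, (N.projDim b * if N.IsCyclic b then c else 0 : ℚ) =
      (n * N.weight a) * c := by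
    have hn : (n : ℚ) ≠ 0 := by exact_mod_cast NeZero.ne n
    have himg : (Finset.univ.filter fun b => N.SameComponent a b ∧ N.IsCyclic b) =
        (Finset.range (minimalPeriod N.gamma a)).image fun i => N.gamma^[i] a := by
      ext b
      simp only [Finset.mem_filter, Finset.mem_univ, true_and, Finset.mem_image, Finset.mem_range]
      constructor
      · rintro ⟨hb, hb'⟩
        obtain ⟨i, rfl⟩ := hb'.exists_iterate_eq hb
        exact ⟨i % minimalPeriod N.gamma a,
          Nat.mod_lt _ (minimalPeriod_pos_of_mem_periodicPts ha),
          iterate_mod_minimalPeriod_eq⟩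
      · rintro ⟨i, -, rfl⟩
        exact ⟨N.sameComponent_iterate a i, ha.iterate i⟩
    rw [weight, mul_div_cancel₀ _ hn, Finset.sum_mul]
    simp only [mul_ite, mul_zero]
    rw [← Finset.sum_filter, Finset.filter_filter, himg, Finset.sum_image]
    intro i hi j hj hij
    exact iterate_injOn_Iio_minimalPeriod (by simpa using hi) (by simpa using hj) hij
  rw [horbit] at heq
  have hpos : (N.componentCard a : ℚ) ≠ 0 := by
    have : Nonempty {b : ZMod n // N.SameComponent a b} := ⟨⟨a, N.sameComponent_iterate a 0⟩⟩
    exact_mod_cast Nat.card_pos.ne'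
  have hw : (n * N.weight a : ℚ) ≠ 0 := by
    intro h
    rw [h, zero_mul] at heq
    exact hpos heq
  rw [heq, mul_div_cancel_left₀ _ hw]
  exact hc

end

end NakayamaPresentation

theorem theorem2p5 {k : Type u} [Field k] {n : ℕ} [NeZero n]
    {A : Type v} [Ring A] [Algebra k A] [FiniteDimensional k A]
    (N : NakayamaPresentation k n A) :
    (∃! α : ZMod n → RatFunc ℚ, N.IsWeighting α) ∧
    (∀ α : ZMod n → RatFunc ℚ, N.IsWeighting α → ∀ a : ZMod n,
      (¬ N.IsCyclic a → (α a).HasValueAtOne 0) ∧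
      (N.IsCyclic a → ∀ c : ZMod n, N.IsCyclic c →
        (α a).HasValueAtOne ((N.componentCard a : ℚ) / ((n : ℚ) * N.weight c)))) ∧
    ((∃ a : ZMod n, N.IsCyclic a ∧ ∃ m : ℕ, N.simpleInjDim a = ((2 * m : ℕ) : WithBot ℕ∞)) ↔
      N.IsConnected ∧ ∀ c : ZMod n, N.IsCyclic c → N.weight c = 1) := by
  refine ⟨N.existsUnique_isWeighting, fun α hα a => ⟨hα.hasValueAtOne_of_not_isCyclic,
    fun ha c hc => ?_⟩, N.exists_isCyclic_simpleInjDim_eq_iff⟩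
  rw [N.weight_eq_of_isCyclic hc ha]
  exact hα.hasValueAtOne_of_isCyclic ha
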